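/- Let $\mathcal S(D^2,4n)$ be the relative Kauffman bracket skein module over $\mathbb{Q}(A)$ of a rectangle with $2n$ marked points on the top edge and $2n$ on the bottom edge: formal linear combinations of framed tangles (represented by tangle diagrams with the blackboard framing) up to isotopy, modulo the Kauffman relations $$\text{crossing} = A\cdot(\text{$A$-smoothing}) + A^{-1}\cdot(\text{$B$-smoothing}),\qquad L\sqcup \bigcirc = -(A^2+A^{-2})\,L .$$ Divide the marked points into four groups of $n$ consecutive points, at top left, top right, bottom left and bottom right. Let $f^{(m)}$ be the $m$-th Jones–Wenzl idempotent, given by Wenzl's recursion: $f^{(0)}$ is the empty tangle, $f^{(1)}$ is a single strand, and $$f^{(m+2)} = (f^{(m+1)}\otimes 1) - \frac{\Delta_m}{\Delta_{m+1}}\,(f^{(m+1)}\otimes 1)\, e_{m+1}\,(f^{(m+1)}\otimes 1),\qquad \Delta_m=(-1)^m\frac{A^{2(m+1)}-A^{-2(m+1)}}{A^2-A^{-2}},$$ where $e_{m+1}$ is the hook (a cup followed by a cap) on the last two of $m+2$ strands. Let $X_n$ be the skein element in which $n$ parallel strands from top left to bottom right cross over $n$ parallel strands from top right to bottom left, with $f^{(n)}$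 inserted at each of the four groups of endpoints (the crossing of two $n$-colored strands). For $0\le k\le n$ let $\Lambda_{n,k}$ be the crossingless skein element, again with $f^{(n)}$ inserted at each of the four groups, in which $n-k$ nested arcs join the top left group to the top right group, $n-k$ nested arcs join the bottom left group to the bottom right group, $k$ parallel strands join top left to bottom left, and $k$ parallel strands join top right to bottom right. Then for every $n\ge 0$ $$X_n=\sum_{k=0}^{n} C_{n,k}\,\Lambda_{n,k},\qquad C_{n,k}=A^{n(n-2k)}\genfrac{[}{]}{0pt}{}{n}{k}_A ,$$ where $$\genfrac{[}{]}{0pt}{}{n}{k}_A=\frac{[n]!}{[k]!\,[n-k]!},\qquad [m]!=[1][2]\cdots[m],\qquad [m]=\frac{A^{2m}-A^{-2m}}{A^2-A^{-2}} .$$ -/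

import Mathlib

open Finset

noncomputable section

namespace KauffmanSkein

/-! ### Tangle diagrams in a rectangle

A tangle diagram in the rectangle, with `m` marked points on the top edge and `n` marked points on
the bottom edge, is put in general position with respect to the height function and cut into
horizontal layers. It is recorded as the list of its layers, read from top to bottom. -/

/-- The elementary tangles.
* `cup` is the arc joining two neighbouring points of its top edge;
* `cap` is the arc joining two neighbouring points of its bottom edge;
* `over` is the crossing whose strand from top left to bottom right is the overcrossing strand;
* `under` is the crossing whose strand from top left to bottom right is the undercrossing strand. -/
inductive Piece
  | cup
  | cap
  | over
  | under

/-- The number of endpoints on the top edge. -/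
def Piece.src : Piece → ℕ
  | .cup => 2
  | .cap => 0
  | .over => 2
  | .under => 2

/-- The number of endpoints on the bottom edge. -/
def Piece.tgt : Piece → ℕ
  | .cup => 0
  | .cap => 2
  | .over => 2
  | .under => 2

/-- A horizontal layer: one elementary tangle, with `left` vertical strands on its left and `right`
vertical strands on its right. -/
@[ext]
structure Layer where
  left : ℕ
  piece : Piece
  right : ℕ

/-- Add `l` vertical strands on the left and `r` vertical strands on the right. -/
def Layer.whisker (l r : ℕ) (L : Layer) : Layer := ⟨l + L.left, L.piece, L.right + r⟩

/-- The layers fit together to a diagram with `m` top points and `n` bottom points. -/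
def IsWord : ℕ → ℕ → List Layer → Prop
  | m, n, [] => m = n
  | m, n, L :: w =>
      m = L.left + L.piece.src + L.right ∧ IsWord (L.left + L.piece.tgt + L.right) n w

theorem IsWord.append {m p n : ℕ} {a b : List Layer} (ha : IsWord m p a) (hb : IsWord p n b) :
    IsWord m n (a ++ b) := by
  induction a generalizing m with
  | nil => cases ha; exact hb
  | cons L w ih => exact ⟨ha.1, ih ha.2⟩

theorem IsWord.whisker {m n : ℕ} {a : List Layer} (l r : ℕ) (ha : IsWord m n a) :
    IsWord (l + m + r) (l + n + r) (a.map (Layer.whisker l r)) := by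
  induction a generalizing m with
  | nil => cases ha; rfl
  | cons L w ih =>
    obtain ⟨h1, h2⟩ := ha
    refine ⟨by simp only [Layer.whisker]; omega, ?_⟩
    have h := ih h2
    have e : l + (L.left + L.piece.tgt + L.right) + r =
      (L.whisker l r).left + (L.whisker l r).piece.tgt + (L.whisker l r).right := by
      simp only [Layer.whisker]; omega
    rwa [e] at h

/-- Tangle diagrams with `m` points on the top edge and `n` points on the bottom edge. -/
@[ext]
structure Diagram (m n : ℕ) where
  word : List Layer
  valid : IsWord m n word

/-- `n` vertical strands. -/
def Diagram.id (n : ℕ) : Diagram n n := ⟨[], rfl⟩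

/-- A single arc joining two top points. -/
def Diagram.cup : Diagram 2 0 := ⟨[⟨0, .cup, 0⟩], rfl, rfl⟩

/-- A single arc joining two bottom points. -/
def Diagram.cap : Diagram 0 2 := ⟨[⟨0, .cap, 0⟩], rfl, rfl⟩

/-- A single crossing; the strand from top left to bottom right is on top. -/
def Diagram.over : Diagram 2 2 := ⟨[⟨0, .over, 0⟩], rfl, rfl⟩

/-- A single crossing; the strand from top right to bottom left is on top. -/
def Diagram.under : Diagram 2 2 := ⟨[⟨0, .under, 0⟩], rfl, rfl⟩

/-- Vertical concatenation, with `a` on top of `b`. -/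
def Diagram.comp {m p n : ℕ} (a : Diagram m p) (b : Diagram p n) : Diagram m n :=
  ⟨a.word ++ b.word, a.valid.append b.valid⟩

/-- Add `l` vertical strands on the left and `r` vertical strands on the right. -/
def Diagram.whisker {m n : ℕ} (l r : ℕ) (a : Diagram m n) : Diagram (l + m + r) (l + n + r) :=
  ⟨a.word.map (Layer.whisker l r), a.valid.whisker l r⟩

/-- Add `k` vertical strands on the left. -/
def Diagram.addLeft (k : ℕ) {m n : ℕ} (a : Diagram m n) : Diagram (k + m) (k + n) :=
  ⟨a.word.map (Layer.whisker k 0), a.valid.whisker k 0⟩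

/-- Add `k` vertical strands on the right. -/
def Diagram.addRight (k : ℕ) {m n : ℕ} (a : Diagram m n) : Diagram (m + k) (n + k) :=
  ⟨a.word.map (Layer.whisker 0 k), by
    have h := a.valid.whisker 0 k
    rwa [Nat.zero_add, Nat.zero_add] at h⟩

/-! ### Isotopy of framed tangles -/

/-- The local moves that generate isotopy of framed tangles with the blackboard framing: planar
isotopy, the Reidemeister moves II and III, the framed form of Reidemeister move I, and the moves
that slide a strand across a maximum or a minimum. They are words with the same
number of top points and the same number of bottom points on both sides. -/
inductive Move : List Layer → List Layer → Prop
  /-- Change the order of the heights of two pieces that lie `m` vertical strands apart. -/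
  | interchange (P Q : Piece) (m : ℕ) :
      Move [⟨0, P, m + Q.src⟩, ⟨P.tgt + m, Q, 0⟩] [⟨P.src + m, Q, 0⟩, ⟨0, P, m + Q.tgt⟩]
  /-- Straighten a zigzag. -/
  | zigzagRight : Move [⟨1, .cap, 0⟩, ⟨0, .cup, 1⟩] []
  | zigzagLeft : Move [⟨0, .cap, 1⟩, ⟨1, .cup, 0⟩] []
  /-- Reidemeister move II. -/
  | overUnder : Move [⟨0, .over, 0⟩, ⟨0, .under, 0⟩] []
  | underOver : Move [⟨0, .under, 0⟩, ⟨0, .over, 0⟩] []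
  /-- Reidemeister move III. -/
  | braid : Move [⟨0, .over, 1⟩, ⟨1, .over, 0⟩, ⟨0, .over, 1⟩]
      [⟨1, .over, 0⟩, ⟨0, .over, 1⟩, ⟨1, .over, 0⟩]
  /-- Slide a strand across a maximum. -/
  | capOver : Move [⟨0, .cap, 1⟩, ⟨1, .over, 0⟩] [⟨1, .cap, 0⟩, ⟨0, .under, 1⟩]
  | capUnder : Move [⟨0, .cap, 1⟩, ⟨1, .under, 0⟩] [⟨1, .cap, 0⟩, ⟨0, .over, 1⟩]
  /-- Slide a strand across a minimum. -/
  | cupOver : Move [⟨1, .over, 0⟩, ⟨0, .cup, 1⟩] [⟨0, .under, 1⟩, ⟨1, .cup, 0⟩]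
  | cupUnder : Move [⟨1, .under, 0⟩, ⟨0, .cup, 1⟩] [⟨0, .over, 1⟩, ⟨1, .cup, 0⟩]
  /-- Framed Reidemeister move I: two kinks of the same framing, on either side of a strand. -/
  | kink : Move [⟨1, .cap, 0⟩, ⟨0, .over, 1⟩, ⟨1, .cup, 0⟩]
      [⟨0, .cap, 1⟩, ⟨1, .over, 0⟩, ⟨0, .cup, 1⟩]

/-! ### The relative Kauffman bracket skein module -/

/-- The field `ℚ(A)`. -/
abbrev K : Type := RatFunc ℚ

/-- The indeterminate `A`. -/
def A : K := RatFunc.X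

/-- Formal `ℚ(A)`-linear combinations of tangle diagrams. -/
abbrev Free (m n : ℕ) : Type := Diagram m n →₀ K

/-- A diagram as a formal linear combination. -/
abbrev Free.of {m n : ℕ} (a : Diagram m n) : Free m n := Finsupp.single a 1

/-- The local relators: the isotopy moves, the Kauffman skein relation for the two kinds of
crossings, and the removal of a trivial circle. -/
inductive LocalRelator : (p q : ℕ) → Free p q → Prop
  | isotopy {p q : ℕ} (u v : Diagram p q) (h : Move u.word v.word) :
      LocalRelator p q (Free.of u - Free.of v)
  | over : LocalRelator 2 2 (Free.of Diagram.over
      - A • Free.of (Diagram.cup.comp Diagram.cap)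
      - A⁻¹ • Free.of (Diagram.id 2))
  | under : LocalRelator 2 2 (Free.of Diagram.under
      - A • Free.of (Diagram.id 2)
      - A⁻¹ • Free.of (Diagram.cup.comp Diagram.cap))
  | circle : LocalRelator 0 0 (Free.of (Diagram.cap.comp Diagram.cup)
      + (A ^ 2 + A⁻¹ ^ 2) • Free.of (Diagram.id 0))

/-- A diagram with `m` top and `n` bottom points, outside a small rectangle with `p` top and `q`
bottom points. -/
structure Surround (p q m n : ℕ) where
  left : ℕ
  right : ℕ
  above : Diagram m (left + p + right)
  below : Diagram (left + q + right) n

/-- Put the diagram `u` into the small rectangle. -/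
def Surround.fill {p q m n : ℕ} (S : Surround p q m n) (u : Diagram p q) : Diagram m n :=
  S.above.comp ((u.whisker S.left S.right).comp S.below)

/-- The submodule generated by all local relators, applied anywhere in a diagram. -/
def relations (m n : ℕ) : Submodule K (Free m n) :=
  Submodule.span K {y | ∃ (p q : ℕ) (S : Surround p q m n) (x : Free p q),
    LocalRelator p q x ∧ y = Finsupp.lmapDomain K K S.fill x}

/-- The relative Kauffman bracket skein module of the rectangle (times an interval) with `m` marked
points on the top edge and `n` marked points on the bottom edge: formal linear combinations of
framed tangles up to isotopy, modulo the Kauffman relations. `Skein n n` is the underlying module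
of the `n`-th Temperley-Lieb algebra. -/
abbrev Skein (m n : ℕ) : Type := Free m n ⧸ relations m n

/-- The skein element of a diagram. -/
def Diagram.toSkein {m n : ℕ} (a : Diagram m n) : Skein m n :=
  (relations m n).mkQ (Free.of a)

theorem relations_le_comap {m n m' n' : ℕ} (F : Diagram m n → Diagram m' n')
    (hF : ∀ (p q : ℕ) (S : Surround p q m n), ∃ T : Surround p q m' n',
      ∀ u, F (S.fill u) = T.fill u) :
    relations m n ≤ (relations m' n').comap (Finsupp.lmapDomain K K F) := by
  refine Submodule.span_le.2 ?_
  rintro _ ⟨p, q, S, x, hx, rfl⟩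
  obtain ⟨T, hT⟩ := hF p q S
  refine Submodule.subset_span ⟨p, q, T, x, hx, ?_⟩
  have e : T.fill = F ∘ S.fill := funext fun u => (hT u).symm
  rw [e, Finsupp.lmapDomain_comp]
  rfl

/-- The linear map of skein modules induced by an operation on diagrams that respects insertion
into small rectangles. -/
def Skein.map {m n m' n' : ℕ} (F : Diagram m n → Diagram m' n')
    (hF : ∀ (p q : ℕ) (S : Surround p q m n), ∃ T : Surround p q m' n',
      ∀ u, F (S.fill u) = T.fill u) : Skein m n →ₗ[K] Skein m' n' :=
  Submodule.mapQ _ _ (Finsupp.lmapDomain K K F) (relations_le_comap F hF)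

theorem surround_comp_left {m k n : ℕ} (a : Diagram m k) (p q : ℕ) (S : Surround p q k n) :
    ∃ T : Surround p q m n, ∀ u, a.comp (S.fill u) = T.fill u :=
  ⟨⟨S.left, S.right, a.comp S.above, S.below⟩, fun u => by
    ext1; simp [Diagram.comp, Surround.fill]⟩

theorem surround_comp_right {m k n : ℕ} (b : Diagram k n) (p q : ℕ) (S : Surround p q m k) :
    ∃ T : Surround p q m n, ∀ u, (S.fill u).comp b = T.fill u :=
  ⟨⟨S.left, S.right, S.above, S.below.comp b⟩, fun u => by
    ext1; simp [Diagram.comp, Surround.fill]⟩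

theorem surround_addLeft {m n : ℕ} (k : ℕ) (p q : ℕ) (S : Surround p q m n) :
    ∃ T : Surround p q (k + m) (k + n), ∀ u, (S.fill u).addLeft k = T.fill u := by
  refine ⟨⟨k + S.left, S.right, ⟨(S.above.addLeft k).word, ?_⟩,
    ⟨(S.below.addLeft k).word, ?_⟩⟩, fun u => ?_⟩
  · simpa only [Nat.add_assoc] using (S.above.addLeft k).valid
  · simpa only [Nat.add_assoc] using (S.below.addLeft k).valid
  · ext1
    simp [Diagram.comp, Surround.fill, Diagram.addLeft, Diagram.whisker, Layer.whisker,
      Nat.add_assoc]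

theorem surround_addRight {m n : ℕ} (k : ℕ) (p q : ℕ) (S : Surround p q m n) :
    ∃ T : Surround p q (m + k) (n + k), ∀ u, (S.fill u).addRight k = T.fill u := by
  refine ⟨⟨S.left, S.right + k, ⟨(S.above.addRight k).word, ?_⟩,
    ⟨(S.below.addRight k).word, ?_⟩⟩, fun u => ?_⟩
  · simpa only [Nat.add_assoc] using (S.above.addRight k).valid
  · simpa only [Nat.add_assoc] using (S.below.addRight k).valid
  · ext1
    simp [Diagram.comp, Surround.fill, Diagram.addRight, Diagram.whisker, Layer.whisker,
      Nat.add_assoc]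

/-- Add `k` vertical strands on the left of a skein element. -/
def Skein.addLeft (k : ℕ) {m n : ℕ} : Skein m n →ₗ[K] Skein (k + m) (k + n) :=
  Skein.map (Diagram.addLeft k) (surround_addLeft k)

/-- Add `k` vertical strands on the right of a skein element. -/
def Skein.addRight (k : ℕ) {m n : ℕ} : Skein m n →ₗ[K] Skein (m + k) (n + k) :=
  Skein.map (Diagram.addRight k) (surround_addRight k)

/-- Vertical concatenation with a formal linear combination of diagrams on top. -/
def compFree (m p n : ℕ) : Free m p →ₗ[K] Skein p n →ₗ[K] Skein m n :=
  Finsupp.linearCombination K fun a => Skein.map a.comp (surround_comp_left a)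

theorem compFree_toSkein {m p n : ℕ} (x : Free m p) (b : Diagram p n) :
    compFree m p n x b.toSkein =
      (relations m n).mkQ (Finsupp.lmapDomain K K (fun a : Diagram m p => a.comp b) x) := by
  induction x using Finsupp.induction_linear with
  | zero => simp
  | add f g hf hg => rw [map_add, LinearMap.add_apply, hf, hg, map_add, map_add]
  | single a c =>
    rw [compFree, Finsupp.linearCombination_single, LinearMap.smul_apply, Diagram.toSkein,
      Skein.map, Submodule.mkQ_apply, Submodule.mapQ_apply, Finsupp.lmapDomain_apply,
      Finsupp.mapDomain_single, Finsupp.lmapDomain_apply, Finsupp.mapDomain_single,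
      Submodule.mkQ_apply, ← Submodule.Quotient.mk_smul, Finsupp.smul_single, smul_eq_mul, mul_one]

theorem relations_le_ker_compFree (m p n : ℕ) :
    relations m p ≤ LinearMap.ker (compFree m p n) := by
  intro x hx
  rw [LinearMap.mem_ker]
  refine Submodule.linearMap_qext _ (Finsupp.lhom_ext' fun b => LinearMap.ext_ring ?_)
  change compFree m p n x b.toSkein = 0
  rw [compFree_toSkein, Submodule.mkQ_apply, Submodule.Quotient.mk_eq_zero]
  exact relations_le_comap (fun a : Diagram m p => a.comp b) (surround_comp_right b) hx

/-- Vertical concatenation of skein elements, as a bilinear map; the first one is on top. On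
`Skein n n` this is the multiplication of the `n`-th Temperley-Lieb algebra. -/
def Skein.comp {m p n : ℕ} : Skein m p →ₗ[K] Skein p n →ₗ[K] Skein m n :=
  Submodule.liftQ _ (compFree m p n) (relations_le_ker_compFree m p n)

/-- Horizontal juxtaposition of skein elements; the first one is on the left. -/
def Skein.tensor {m n m' n' : ℕ} (x : Skein m n) (y : Skein m' n') : Skein (m + m') (n + n') :=
  Skein.comp (Skein.addRight m' x) (Skein.addLeft n y)

theorem comp_toSkein {m p n : ℕ} (a : Diagram m p) (b : Diagram p n) :
    Skein.comp a.toSkein b.toSkein = (a.comp b).toSkein := by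
  have h := compFree_toSkein (Free.of a) b
  rw [Finsupp.lmapDomain_apply, Finsupp.mapDomain_single] at h
  exact h

/-! ### Jones-Wenzl idempotents -/

/-- `Δ_n = (-1)^n (A^{2(n+1)} - A^{-2(n+1)}) / (A^2 - A^{-2})`. -/
def Delta (n : ℕ) : K :=
  (-1) ^ n * ((A ^ (2 * (n + 1)) - A⁻¹ ^ (2 * (n + 1))) / (A ^ 2 - A⁻¹ ^ 2))

/-- On `n + 2` strands, a cup followed by a cap in the last two positions. -/
def hook (n : ℕ) : Diagram (n + 2) (n + 2) :=
  (Diagram.cup.comp Diagram.cap).addLeft n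

/-- The Jones-Wenzl idempotent `f^{(n)}`, by Wenzl's recursion. -/
def jonesWenzl : (n : ℕ) → Skein n n
  | 0 => (Diagram.id 0).toSkein
  | 1 => (Diagram.id 1).toSkein
  | n + 2 =>
      Skein.addRight 1 (jonesWenzl (n + 1))
        - (Delta n / Delta (n + 1)) •
          Skein.comp (Skein.comp (Skein.addRight 1 (jonesWenzl (n + 1))) (hook n).toSkein)
            (Skein.addRight 1 (jonesWenzl (n + 1)))

/-- Four groups of `n` endpoints, at top left, top right, bottom left and bottom right, each
decorated with the `n`-th Jones-Wenzl idempotent, and joined by the diagram `d`. -/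
def decorate (n : ℕ) (d : Diagram (n + n) (n + n)) : Skein (n + n) (n + n) :=
  Skein.comp (Skein.comp (Skein.tensor (jonesWenzl n) (jonesWenzl n)) d.toSkein)
    (Skein.tensor (jonesWenzl n) (jonesWenzl n))

/-! ### The crossing of two bands of parallel strands -/

/-- On `i + n + 1 + s` strands, the strand number `i + n` (counted from `0`) passes to the left,
under the `n` strands before it. -/
def passWord (i s : ℕ) : ℕ → List Layer
  | 0 => []
  | n + 1 => ⟨i + n, .over, s⟩ :: passWord i (s + 1) n

/-- The first `n` strands cross over the `t` strands after them, of which `i` have already been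
moved to the far left. -/
def crossWord (n : ℕ) (i : ℕ) : ℕ → List Layer
  | 0 => []
  | t + 1 => passWord i t n ++ crossWord n (i + 1) t

theorem isWord_passWord (i s n : ℕ) : IsWord (i + n + 1 + s) (i + n + 1 + s) (passWord i s n) := by
  induction n generalizing s with
  | zero => rfl
  | succ n ih =>
    refine ⟨by simp only [Piece.src]; omega, ?_⟩
    have h := ih (s + 1)
    have e1 : i + n + 1 + (s + 1) = i + n + Piece.over.tgt + s := by simp only [Piece.tgt]; omega
    have e2 : i + n + 1 + (s + 1) = i + (n + 1) + 1 + s := by omega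
    rw [e2] at h
    rwa [← e1, e2]

theorem isWord_crossWord (n i t : ℕ) : IsWord (i + n + t) (i + n + t) (crossWord n i t) := by
  induction t generalizing i with
  | zero => rfl
  | succ t ih =>
    refine IsWord.append (p := i + n + (t + 1)) ?_ ?_
    · have h := isWord_passWord i t n
      rwa [show i + n + 1 + t = i + n + (t + 1) by omega] at h
    · have h := ih (i + 1)
      rwa [show i + 1 + n + t = i + n + (t + 1) by omega] at h

/-- The crossing of a band of `n` parallel strands from top left to bottom right over a band of `n`
parallel strands from top right to bottom left. -/
def bandCrossing (n : ℕ) : Diagram (n + n) (n + n) :=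
  ⟨crossWord n 0 n, by simpa using isWord_crossWord n 0 n⟩

/-- The crossing of two `n`-colored strands. -/
def coloredCrossing (n : ℕ) : Skein (n + n) (n + n) := decorate n (bandCrossing n)

/-! ### The crossingless elements -/

/-- `j` nested arcs, each joining two top points, with `k` vertical strands on either side. -/
def cupsWord (k : ℕ) : ℕ → List Layer
  | 0 => []
  | j + 1 => ⟨k + j, .cup, k + j⟩ :: cupsWord k j

/-- `j` nested arcs, each joining two bottom points, with `k` vertical strands on either side. -/
def capsWord (k : ℕ) : ℕ → List Layer
  | 0 => []
  | j + 1 => capsWord k j ++ [⟨k + j, .cap, k + j⟩]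

theorem isWord_cupsWord (k j : ℕ) : IsWord (k + j + (k + j)) (k + k) (cupsWord k j) := by
  induction j with
  | zero => rfl
  | succ j ih => exact ⟨by simp only [Piece.src]; omega, ih⟩

theorem isWord_capsWord (k j : ℕ) : IsWord (k + k) (k + j + (k + j)) (capsWord k j) := by
  induction j with
  | zero => rfl
  | succ j ih =>
    exact ih.append ⟨by simp only [Piece.src]; omega, by simp only [IsWord, Piece.tgt]; omega⟩

/-- The crossingless diagram in which `n - k` nested arcs join the `n` top left points to the `n`
top right points, `n - k` nested arcs join the bottom left points to the bottom right points, `k`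
vertical strands run along the left side, and `k` vertical strands run along the right side. -/
def flatDiagram (n k : ℕ) (hk : k ≤ n) : Diagram (n + n) (n + n) :=
  ⟨cupsWord k (n - k) ++ capsWord k (n - k), by
    have h := (isWord_cupsWord k (n - k)).append (isWord_capsWord k (n - k))
    rwa [Nat.add_sub_cancel' hk] at h⟩

/-- The crossingless skein element on the four `n`-colored ends, with `k` strands on the left side
and on the right side and `n - k` strands on the upper side and on the lower side. -/
def flatElement (n k : ℕ) (hk : k ≤ n) : Skein (n + n) (n + n) := decorate n (flatDiagram n k hk)

/-! ### The coefficients -/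

/-- The quantum integer `[m] = (A^{2m} - A^{-2m}) / (A^2 - A^{-2})`. -/
def quantumInt (m : ℕ) : K := (A ^ (2 * m) - A⁻¹ ^ (2 * m)) / (A ^ 2 - A⁻¹ ^ 2)

/-- The quantum factorial `[m]! = [1] [2] ⋯ [m]`. -/
def quantumFactorial (m : ℕ) : K := ∏ i ∈ range m, quantumInt (i + 1)

/-- The quantum binomial coefficient `[n]! / ([k]! [n - k]!)`, for `k ≤ n`. -/
def quantumBinomial (n k : ℕ) : K :=
  quantumFactorial n / (quantumFactorial k * quantumFactorial (n - k))

/-- `C_{n,k} = A^{n(n-2k)} [n choose k]`. -/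
def coeff (n k : ℕ) : K := A ^ ((n : ℤ) * ((n : ℤ) - 2 * (k : ℤ))) * quantumBinomial n k

end KauffmanSkein

end

noncomputable section

namespace KauffmanSkein

/-! ### The linear category of skein modules -/

/-! A Jones-Wenzl idempotent kills every arc joining two neighbouring points of its own group. So
`decorateMap` vanishes on the subspace `turnback n` spanned by elements with such an arc at the top
or bottom, and it suffices to expand the bare band crossing modulo `turnback n`.

The expansion is an induction that peels one strand off each band. In the crossing of two bands of
`n + 1` strands, the topmost crossing is that of the last overcrossing strand with the first
undercrossing strand; resolve it by the skein relation. In the identity smoothing (factor `A⁻¹`),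
the other `2n` crossings on these two strands lie at the top between strands of the same group.
Modulo turnbacks each contributes `A⁻¹`, leaving the `n`-band crossing with a vertical strand on
either side (`sides`). In the hook smoothing (factor `A`), the lower arc can be slid by isotopy
below the `n`-band crossing. It then ends in `2n` crossings between bottom strands of the same
group, each contributing `A`, leaving the `n`-band crossing between two arcs (`arcs`). Hence, modulo
turnbacks (`mkQ_bandCrossing_succ`), `X_{n+1} = A^{-(2n+1)} sides X_n + A^{2n+1} arcs X_n`.

Both operations respect turnbacks, and they send the flat diagram `(n, k)` to `(n+1, k+1)` and
`(n+1, k)`. The coefficients therefore obey a Pascal rule, which is the quantum binomial recursion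
(`coeff_succ_succ`).

The supporting inputs are the annihilation property of the idempotents (`wenzlProperties`), proved
from Wenzl's recursion, and the sliding identities for products of crossings (`upProd_mul_gridProd`,
`cap_comp_downProd_over`, `cap_comp_upProd_over`). -/

theorem Skein.induction {m n : ℕ} {p : Skein m n → Prop} (hd : ∀ a : Diagram m n, p a.toSkein)
    (hzero : p 0) (hadd : ∀ x y, p x → p y → p (x + y)) (hsmul : ∀ (c : K) x, p x → p (c • x))
    (x : Skein m n) : p x := by
  obtain ⟨y, rfl⟩ := Submodule.mkQ_surjective _ x
  induction y using Finsupp.induction_linear with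
  | zero => rwa [map_zero]
  | add f g hf hg => rw [map_add]; exact hadd _ _ hf hg
  | single a c =>
    have h := hsmul c _ (hd a)
    rwa [Diagram.toSkein, ← map_smul, Finsupp.smul_single, smul_eq_mul, mul_one] at h

theorem comp_assoc {m p q n : ℕ} (x : Skein m p) (y : Skein p q) (z : Skein q n) :
    Skein.comp (Skein.comp x y) z = Skein.comp x (Skein.comp y z) := by
  induction x using Skein.induction with
  | hzero => simp
  | hadd x x' h h' => simp only [map_add, LinearMap.add_apply, h, h']
  | hsmul c x h => simp only [map_smul, LinearMap.smul_apply, h]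
  | hd a =>
    induction y using Skein.induction with
    | hzero => simp
    | hadd x x' h h' => simp only [map_add, LinearMap.add_apply, h, h']
    | hsmul c x h => simp only [map_smul, LinearMap.smul_apply, h]
    | hd b =>
      induction z using Skein.induction with
      | hzero => simp
      | hadd x x' h h' => simp only [map_add, h, h']
      | hsmul c x h => simp only [map_smul, h]
      | hd c => simp only [comp_toSkein, Diagram.comp, List.append_assoc]

theorem id_comp {m n : ℕ} (x : Skein m n) : Skein.comp (Diagram.id m).toSkein x = x := by
  induction x using Skein.induction with
  | hzero => simp
  | hadd x x' h h' => simp only [map_add, h, h']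
  | hsmul c x h => simp only [map_smul, h]
  | hd a => simp only [comp_toSkein, Diagram.comp, Diagram.id, List.nil_append]

theorem comp_id {m n : ℕ} (x : Skein m n) : Skein.comp x (Diagram.id n).toSkein = x := by
  induction x using Skein.induction with
  | hzero => simp
  | hadd x x' h h' => simp only [map_add, LinearMap.add_apply, h, h']
  | hsmul c x h => simp only [map_smul, LinearMap.smul_apply, h]
  | hd a => simp only [comp_toSkein, Diagram.comp, Diagram.id, List.append_nil]

/-- The Temperley-Lieb algebra on `n` strands; products are read from top to bottom. -/
instance (n : ℕ) : Ring (Skein n n) where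
  mul x y := Skein.comp x y
  one := (Diagram.id n).toSkein
  mul_assoc := comp_assoc
  one_mul := id_comp
  mul_one := comp_id
  left_distrib x y z := map_add (Skein.comp x) y z
  right_distrib x y z := by
    change Skein.comp (x + y) z = Skein.comp x z + Skein.comp y z
    rw [map_add, LinearMap.add_apply]
  zero_mul x := by change Skein.comp 0 x = 0; simp
  mul_zero x := map_zero (Skein.comp x)
  -- Integer and natural multiples are those of the quotient module, so the ring structure induces
  -- the additive group already present.
  zsmul := fun k x => k • x
  zsmul_zero' := SubNegMonoid.zsmul_zero'
  zsmul_succ' := SubNegMonoid.zsmul_succ'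
  zsmul_neg' := SubNegMonoid.zsmul_neg'
  nsmul := fun k x => k • x
  nsmul_zero := AddMonoid.nsmul_zero
  nsmul_succ := AddMonoid.nsmul_succ
  neg_add_cancel := neg_add_cancel
  sub_eq_add_neg := sub_eq_add_neg
  add_comm := add_comm

theorem mul_def {n : ℕ} (x y : Skein n n) : x * y = Skein.comp x y := rfl

theorem one_comp {m n : ℕ} (x : Skein m n) : Skein.comp 1 x = x := id_comp x

theorem comp_one {m n : ℕ} (x : Skein m n) : Skein.comp x 1 = x := comp_id x

theorem comp_mul {m n : ℕ} (x : Skein m n) (y z : Skein n n) :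
    Skein.comp x (y * z) = Skein.comp (Skein.comp x y) z := (comp_assoc x y z).symm

theorem mul_comp {m n : ℕ} (x y : Skein m m) (z : Skein m n) :
    Skein.comp (x * y) z = Skein.comp x (Skein.comp y z) := comp_assoc x y z

instance (n : ℕ) : Algebra K (Skein n n) :=
  Algebra.ofModule
    (fun c x y => by rw [mul_def, mul_def, map_smul, LinearMap.smul_apply])
    (fun c x y => by rw [mul_def, mul_def, map_smul])

/-! ### Words -/

theorem isWord_append_iff {m p n : ℕ} {a b : List Layer} (ha : IsWord m p a) :
    IsWord m n (a ++ b) ↔ IsWord p n b := by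
  refine ⟨fun h => ?_, ha.append⟩
  induction a generalizing m with
  | nil => cases ha; exact h
  | cons L w ih => exact ih ha.2 h.2

/-- The skein element of a word; it is `0` if the layers do not fit together. -/
def ofWord (m n : ℕ) (w : List Layer) : Skein m n :=
  open Classical in if h : IsWord m n w then Diagram.toSkein ⟨w, h⟩ else 0

theorem toSkein_eq_ofWord {m n : ℕ} (a : Diagram m n) : a.toSkein = ofWord m n a.word := by
  rw [ofWord, dif_pos a.valid]

theorem ofWord_nil (n : ℕ) : ofWord n n [] = 1 := (toSkein_eq_ofWord (Diagram.id n)).symm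

theorem ofWord_of_not {m n : ℕ} {w : List Layer} (h : ¬IsWord m n w) : ofWord m n w = 0 :=
  dif_neg h

/-- If `b` does not fit, neither does `a ++ b`, and both sides are `0`. -/
theorem comp_ofWord {m p n : ℕ} {a b : List Layer} (ha : IsWord m p a) :
    Skein.comp (ofWord m p a) (ofWord p n b) = ofWord m n (a ++ b) := by
  by_cases hb : IsWord p n b
  · rw [ofWord, dif_pos ha, ofWord, dif_pos hb, comp_toSkein, ofWord, dif_pos (ha.append hb)]
    rfl
  · rw [ofWord_of_not hb, ofWord_of_not (mt (isWord_append_iff ha).1 hb), map_zero]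

theorem mkQ_fill_eq_zero {p q m n : ℕ} {x : Free p q} (hx : LocalRelator p q x)
    (S : Surround p q m n) :
    (relations m n).mkQ (Finsupp.lmapDomain K K S.fill x) = 0 := by
  rw [Submodule.mkQ_apply, Submodule.Quotient.mk_eq_zero]
  exact Submodule.subset_span ⟨p, q, S, x, hx, rfl⟩

/-- The rectangle with `l` strands on the left and `r` strands on the right. -/
def strip {p q m n : ℕ} (l r : ℕ) (hm : m = l + p + r) (hn : n = l + q + r) : Surround p q m n :=
  ⟨l, r, ⟨[], hm⟩, ⟨[], hn.symm⟩⟩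

theorem mkQ_lmapDomain_strip {p q m n : ℕ} (l r : ℕ) (hm : m = l + p + r) (hn : n = l + q + r)
    (u : Diagram p q) :
    (relations m n).mkQ (Finsupp.lmapDomain K K (strip l r hm hn).fill (Free.of u)) =
      ofWord m n (u.word.map (Layer.whisker l r)) := by
  rw [Finsupp.lmapDomain_apply, Finsupp.mapDomain_single]
  change ((strip l r hm hn).fill u).toSkein = _
  rw [toSkein_eq_ofWord]
  simp [Surround.fill, strip, Diagram.comp, Diagram.whisker]

/-- A relator with strands only at its sides suffices: whatever lies above and below is supplied by
composition. -/
theorem ofWord_move {p q m n : ℕ} (l r : ℕ) (hm : m = l + p + r) (hn : n = l + q + r)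
    {u v : List Layer} (h : Move u v) (hu : IsWord p q u) (hv : IsWord p q v) :
    ofWord m n (u.map (Layer.whisker l r)) = ofWord m n (v.map (Layer.whisker l r)) := by
  have e := mkQ_fill_eq_zero (LocalRelator.isotopy ⟨u, hu⟩ ⟨v, hv⟩ h) (strip l r hm hn)
  rw [map_sub, map_sub, mkQ_lmapDomain_strip, mkQ_lmapDomain_strip, sub_eq_zero] at e
  exact e

/-! ### Generators -/

/-- The layer on `m` strands with the piece `P` after `i` vertical strands; it is `0` if it does not
fit between `m` top points and `n` bottom points. -/
def gen (P : Piece) (m n i : ℕ) : Skein m n := ofWord m n [⟨i, P, m - (i + P.src)⟩]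

theorem gen_eq_ofWord {P : Piece} {m n i : ℕ} (r : ℕ) (h : m = i + P.src + r) :
    gen P m n i = ofWord m n [⟨i, P, r⟩] := by
  rw [gen, h, Nat.add_sub_cancel_left]

theorem gen_eq_zero {P : Piece} {m n i : ℕ} (h : ¬(i + P.src ≤ m ∧ n + P.src = m + P.tgt)) :
    gen P m n i = 0 := by
  refine ofWord_of_not fun hw => h ?_
  obtain ⟨h1, h2⟩ := hw
  simp only [IsWord] at h1 h2
  omega

theorem gen_comp_ofWord {P : Piece} {m n p i r : ℕ} {w : List Layer} (hm : m = i + P.src + r)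
    (hp : p = i + P.tgt + r) :
    Skein.comp (gen P m p i) (ofWord p n w) = ofWord m n (⟨i, P, r⟩ :: w) := by
  rw [gen_eq_ofWord r hm, comp_ofWord]
  · rfl
  · exact ⟨hm, hp.symm⟩

/-- Skein elements are linear combinations of products of generators. -/
theorem Skein.induction_gen {p : (m n : ℕ) → Skein m n → Prop} (hone : ∀ n, p n n 1)
    (hgen : ∀ (P : Piece) (i r n : ℕ) (x : Skein (i + P.tgt + r) n), p _ _ x →
      p (i + P.src + r) n (Skein.comp (gen P _ _ i) x))
    (hzero : ∀ m n, p m n 0) (hadd : ∀ m n x y, p m n x → p m n y → p m n (x + y))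
    (hsmul : ∀ m n (c : K) x, p m n x → p m n (c • x)) {m n : ℕ} (x : Skein m n) : p m n x := by
  induction x using Skein.induction with
  | hzero => exact hzero m n
  | hadd x x' h h' => exact hadd m n _ _ h h'
  | hsmul c x h => exact hsmul m n _ _ h
  | hd a =>
    rw [toSkein_eq_ofWord]
    obtain ⟨w, hw⟩ := a
    change p m n (ofWord m n w)
    induction w generalizing m with
    | nil => cases hw; rw [ofWord_nil]; exact hone _
    | cons L w ih =>
      obtain ⟨i, P, r⟩ := L
      obtain ⟨rfl, h2⟩ := hw
      rw [← gen_comp_ofWord rfl rfl]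
      exact hgen _ _ _ _ _ (ih h2)

theorem gen_comp_gen {P Q : Piece} {m n p i j : ℕ} (r s : ℕ) (hm : m = i + P.src + r)
    (hp : p = i + P.tgt + r) (hq : p = j + Q.src + s) :
    Skein.comp (gen P m p i) (gen Q p n j) = ofWord m n [⟨i, P, r⟩, ⟨j, Q, s⟩] := by
  rw [gen_eq_ofWord s hq, gen_comp_ofWord hm hp]

/-- When the lower layer on the left does not fit, both sides are `0`. Far commutation thus holds at
all indices, as the abstract product lemmas require. -/
theorem gen_interchange (P Q : Piece) {m p p' n i j k : ℕ} (hp : p + P.src = m + P.tgt)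
    (hp' : p' + Q.src = m + Q.tgt) (hj : i + P.src ≤ j) (hk : k + P.src = j + P.tgt) :
    Skein.comp (gen P m p i) (gen Q p n k) = Skein.comp (gen Q m p' j) (gen P p' n i) := by
  by_cases h : j + Q.src ≤ m ∧ n + Q.src = p + Q.tgt
  · obtain ⟨d, rfl⟩ := Nat.exists_eq_add_of_le hj
    obtain ⟨r, hr⟩ := Nat.exists_eq_add_of_le h.1
    obtain ⟨h1, h2⟩ := h
    obtain rfl : k = i + P.tgt + d := by omega
    rw [gen_comp_gen (P := P) (Q := Q) (d + Q.src + r) r (by omega) (by omega) (by omega),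
      gen_comp_gen (P := Q) (Q := P) r (d + Q.tgt + r) (by omega) (by omega) (by omega)]
    have e := ofWord_move (m := m) (n := n) (p := P.src + d + Q.src) (q := P.tgt + d + Q.tgt) i r
      (by omega) (by omega) (Move.interchange P Q d)
      ⟨by simp only; omega, by simp only; omega, by simp only [IsWord]; omega⟩
      ⟨by simp only; omega, by simp only; omega, by simp only [IsWord]; omega⟩
    simpa [Layer.whisker, Nat.add_assoc] using e
  · rw [gen_eq_zero (P := Q) (m := p) (by omega), map_zero]
    by_cases h' : n + Q.src = p + Q.tgt
    · rw [gen_eq_zero (P := Q) (m := m) (by omega), map_zero, LinearMap.zero_apply]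
    · rw [gen_eq_zero (P := P) (m := p') (by omega), map_zero]

theorem cap_comp_cup_left {m p i : ℕ} (hp : p = m + 2) (hi : i + 1 ≤ m) :
    Skein.comp (gen .cap m p (i + 1)) (gen .cup p m i) = 1 := by
  subst hp
  obtain ⟨r, rfl⟩ := Nat.exists_eq_add_of_le hi
  rw [gen_comp_gen r (r + 1) (by simp +arith [Piece.src]) (by simp +arith [Piece.tgt])
    (by simp +arith [Piece.src]), ← ofWord_nil]
  have e := ofWord_move (m := i + 1 + r) (n := i + 1 + r) (p := 1) (q := 1) i r rfl rfl
    Move.zigzagRight ⟨rfl, rfl, rfl⟩ rfl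
  simpa [Layer.whisker, Nat.add_comm] using e

theorem cap_comp_cup_right {m p i : ℕ} (hp : p = m + 2) (hi : i + 1 ≤ m) :
    Skein.comp (gen .cap m p i) (gen .cup p m (i + 1)) = 1 := by
  subst hp
  obtain ⟨r, rfl⟩ := Nat.exists_eq_add_of_le hi
  rw [gen_comp_gen (r + 1) r (by simp +arith [Piece.src]) (by simp +arith [Piece.tgt])
    (by simp +arith [Piece.src]), ← ofWord_nil]
  have e := ofWord_move (m := i + 1 + r) (n := i + 1 + r) (p := 1) (q := 1) i r rfl rfl
    Move.zigzagLeft ⟨rfl, rfl, rfl⟩ rfl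
  simpa [Layer.whisker, Nat.add_comm] using e

theorem over_mul_under {m i : ℕ} (hi : i + 2 ≤ m) : gen .over m m i * gen .under m m i = 1 := by
  obtain ⟨r, rfl⟩ := Nat.exists_eq_add_of_le hi
  rw [mul_def, gen_comp_gen r r (by simp +arith [Piece.src]) (by simp +arith [Piece.tgt]) (by simp +arith [Piece.src]), ← ofWord_nil]
  have e := ofWord_move (m := i + 2 + r) (n := i + 2 + r) (p := 2) (q := 2) i r rfl rfl
    Move.overUnder ⟨rfl, rfl, rfl⟩ rfl
  simpa [Layer.whisker] using e

theorem under_mul_over {m i : ℕ} (hi : i + 2 ≤ m) : gen .under m m i * gen .over m m i = 1 := by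
  obtain ⟨r, rfl⟩ := Nat.exists_eq_add_of_le hi
  rw [mul_def, gen_comp_gen r r (by simp +arith [Piece.src]) (by simp +arith [Piece.tgt]) (by simp +arith [Piece.src]), ← ofWord_nil]
  have e := ofWord_move (m := i + 2 + r) (n := i + 2 + r) (p := 2) (q := 2) i r rfl rfl
    Move.underOver ⟨rfl, rfl, rfl⟩ rfl
  simpa [Layer.whisker] using e

theorem over_braid (m i : ℕ) :
    gen .over m m i * gen .over m m (i + 1) * gen .over m m i =
      gen .over m m (i + 1) * gen .over m m i * gen .over m m (i + 1) := by
  by_cases hi : i + 3 ≤ m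
  · obtain ⟨r, rfl⟩ := Nat.exists_eq_add_of_le hi
    simp only [mul_assoc]
    simp only [mul_def]
    rw [gen_comp_gen (i := i + 1) r (r + 1) (by simp +arith [Piece.src]) (by simp +arith [Piece.tgt]) (by simp +arith [Piece.src]),
      gen_comp_gen (i := i) (r + 1) r (by simp +arith [Piece.src]) (by simp +arith [Piece.tgt]) (by simp +arith [Piece.src]),
      gen_comp_ofWord (r := r + 1) (by simp +arith [Piece.src]) (by simp +arith [Piece.tgt]),
      gen_comp_ofWord (r := r) (by simp +arith [Piece.src]) (by simp +arith [Piece.tgt])]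
    have e := ofWord_move (m := i + 3 + r) (n := i + 3 + r) (p := 3) (q := 3) i r rfl rfl
      Move.braid ⟨rfl, rfl, rfl, rfl⟩ ⟨rfl, rfl, rfl, rfl⟩
    simpa [Layer.whisker, Nat.add_comm 1 r] using e
  · rw [gen_eq_zero (i := i + 1) (by simp only [Piece.src]; omega)]
    simp

/-- The braid relation multiplied by `under i` on the left and by `under (i + 1)` on the right. -/
theorem under_mul_over_mul_over (m i : ℕ) :
    gen .under m m i * (gen .over m m (i + 1) * gen .over m m i) =
      gen .over m m (i + 1) * gen .over m m i * gen .under m m (i + 1) := by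
  by_cases hi : i + 3 ≤ m
  · have h1 := under_mul_over (m := m) (i := i) (by omega)
    have h2 := over_mul_under (m := m) (i := i + 1) (by omega)
    calc _ = gen .under m m i * (gen .over m m (i + 1) * gen .over m m i *
            gen .over m m (i + 1)) * gen .under m m (i + 1) := by
          simp only [mul_assoc, h2, mul_one]
      _ = _ := by
          rw [← over_braid]
          simp only [← mul_assoc, h1, one_mul]
  · rw [gen_eq_zero (P := .over) (i := i + 1) (by simp only [Piece.src]; omega)]
    simp

theorem cap_succ_comp_over {m p i : ℕ} (hp : p = m + 2) :
    Skein.comp (gen .cap m p (i + 1)) (gen .over p p i) =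
      Skein.comp (gen .cap m p i) (gen .under p p (i + 1)) := by
  by_cases hi : i + 1 ≤ m
  · obtain ⟨r, rfl⟩ := Nat.exists_eq_add_of_le hi
    subst hp
    rw [gen_comp_gen r (r + 1) (by simp +arith [Piece.src]) (by simp +arith [Piece.tgt]) (by simp +arith [Piece.src]),
      gen_comp_gen (r + 1) r (by simp +arith [Piece.src]) (by simp +arith [Piece.tgt])
      (by simp +arith [Piece.src])]
    have e := ofWord_move (m := i + 1 + r) (n := i + 1 + r + 2) (p := 1) (q := 3) i r rfl (by omega)
      Move.capUnder ⟨rfl, rfl, rfl⟩ ⟨rfl, rfl, rfl⟩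
    simpa [Layer.whisker, Nat.add_comm 1 r] using e.symm
  · rw [gen_eq_zero (i := i + 1) (by simp only [Piece.src]; omega),
      gen_eq_zero (P := .under) (i := i + 1) (by simp only [Piece.src]; omega)]
    simp

theorem cap_comp_over_succ {m p i : ℕ} (hp : p = m + 2) :
    Skein.comp (gen .cap m p i) (gen .over p p (i + 1)) =
      Skein.comp (gen .cap m p (i + 1)) (gen .under p p i) := by
  by_cases hi : i + 1 ≤ m
  · obtain ⟨r, rfl⟩ := Nat.exists_eq_add_of_le hi
    subst hp
    rw [gen_comp_gen (P := .cap) (i := i + 1) r (r + 1) (by simp +arith [Piece.src]) (by simp +arith [Piece.tgt])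
        (by simp +arith [Piece.src]),
      gen_comp_gen (r + 1) r (by simp +arith [Piece.src]) (by simp +arith [Piece.tgt])
      (by simp +arith [Piece.src])]
    have e := ofWord_move (m := i + 1 + r) (n := i + 1 + r + 2) (p := 1) (q := 3) i r rfl (by omega)
      Move.capOver ⟨rfl, rfl, rfl⟩ ⟨rfl, rfl, rfl⟩
    simpa [Layer.whisker, Nat.add_comm 1 r] using e
  · rw [gen_eq_zero (P := .cap) (i := i + 1) (by simp only [Piece.src]; omega),
      gen_eq_zero (P := .over) (i := i + 1) (by simp only [Piece.src]; omega)]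
    simp

/-- On `m` strands, a cup followed by a cap, after `i` vertical strands. -/
def hookAt (m i : ℕ) : Skein m m := Skein.comp (gen .cup m (m - 2) i) (gen .cap (m - 2) m i)

theorem hookAt_eq {m p : ℕ} (hp : m = p + 2) (i : ℕ) :
    hookAt m i = Skein.comp (gen .cup m p i) (gen .cap p m i) := by
  subst hp; rfl

theorem over_eq {m i : ℕ} (hi : i + 2 ≤ m) :
    gen .over m m i = A • hookAt m i + A⁻¹ • (1 : Skein m m) := by
  obtain ⟨r, rfl⟩ := Nat.exists_eq_add_of_le hi
  have e := mkQ_fill_eq_zero LocalRelator.over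
    (strip (m := i + 2 + r) (n := i + 2 + r) i r rfl rfl)
  rw [map_sub, map_sub, map_sub, map_sub, map_smul, map_smul, map_smul, map_smul,
    mkQ_lmapDomain_strip, mkQ_lmapDomain_strip, mkQ_lmapDomain_strip, sub_sub, sub_eq_zero] at e
  rw [gen_eq_ofWord r (by simp +arith [Piece.src]), hookAt_eq (p := i + r) (by omega), gen_comp_gen r r (by simp +arith [Piece.src]) (by simp +arith [Piece.tgt]) (by simp +arith [Piece.src]),
    ← ofWord_nil]
  simpa [Layer.whisker, Diagram.over, Diagram.cup, Diagram.cap, Diagram.comp, Diagram.id] using e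

theorem under_eq {m i : ℕ} (hi : i + 2 ≤ m) :
    gen .under m m i = A • (1 : Skein m m) + A⁻¹ • hookAt m i := by
  obtain ⟨r, rfl⟩ := Nat.exists_eq_add_of_le hi
  have e := mkQ_fill_eq_zero LocalRelator.under
    (strip (m := i + 2 + r) (n := i + 2 + r) i r rfl rfl)
  rw [map_sub, map_sub, map_sub, map_sub, map_smul, map_smul, map_smul, map_smul,
    mkQ_lmapDomain_strip, mkQ_lmapDomain_strip, mkQ_lmapDomain_strip, sub_sub, sub_eq_zero] at e
  rw [gen_eq_ofWord r (by simp +arith [Piece.src]), hookAt_eq (p := i + r) (by omega), gen_comp_gen r r (by simp +arith [Piece.src]) (by simp +arith [Piece.tgt]) (by simp +arith [Piece.src]),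
    ← ofWord_nil]
  simpa [Layer.whisker, Diagram.under, Diagram.cup, Diagram.cap, Diagram.comp, Diagram.id] using e

theorem cap_comp_cup {m p i : ℕ} (hp : p = m + 2) (hi : i ≤ m) :
    Skein.comp (gen .cap m p i) (gen .cup p m i) = (-(A ^ 2 + A⁻¹ ^ 2)) • (1 : Skein m m) := by
  subst hp
  obtain ⟨r, rfl⟩ := Nat.exists_eq_add_of_le hi
  have e := mkQ_fill_eq_zero LocalRelator.circle (strip (m := i + r) (n := i + r) i r rfl rfl)
  rw [map_add, map_add, map_smul, map_smul, mkQ_lmapDomain_strip, mkQ_lmapDomain_strip,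
    ← eq_neg_iff_add_eq_zero, ← neg_smul] at e
  rw [gen_comp_gen r r (by simp +arith [Piece.src]) (by simp +arith [Piece.tgt]) (by simp +arith [Piece.src]), ← ofWord_nil]
  simpa [Layer.whisker, Diagram.cup, Diagram.cap, Diagram.comp, Diagram.id] using e

/-! ### Adding vertical strands -/

theorem map_toSkein {m n m' n' : ℕ} (F : Diagram m n → Diagram m' n')
    (hF : ∀ (p q : ℕ) (S : Surround p q m n), ∃ T : Surround p q m' n',
      ∀ u, F (S.fill u) = T.fill u) (a : Diagram m n) :
    Skein.map F hF a.toSkein = (F a).toSkein := by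
  rw [Diagram.toSkein, Skein.map, Submodule.mkQ_apply, Submodule.mapQ_apply,
    Finsupp.lmapDomain_apply, Finsupp.mapDomain_single]
  rfl

theorem addRight_ofWord (k : ℕ) {m n : ℕ} {w : List Layer} (h : IsWord m n w) :
    Skein.addRight k (ofWord m n w) = ofWord (m + k) (n + k) (w.map (Layer.whisker 0 k)) := by
  rw [ofWord, dif_pos h, Skein.addRight, map_toSkein, toSkein_eq_ofWord]
  rfl

theorem addLeft_ofWord (k : ℕ) {m n : ℕ} {w : List Layer} (h : IsWord m n w) :
    Skein.addLeft k (ofWord m n w) = ofWord (k + m) (k + n) (w.map (Layer.whisker k 0)) := by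
  rw [ofWord, dif_pos h, Skein.addLeft, map_toSkein, toSkein_eq_ofWord]
  rfl

theorem addRight_one (k n : ℕ) : Skein.addRight k (1 : Skein n n) = 1 := by
  rw [← ofWord_nil, addRight_ofWord k (show IsWord n n [] from rfl), List.map_nil, ofWord_nil]

theorem addLeft_one (k n : ℕ) : Skein.addLeft k (1 : Skein n n) = 1 := by
  rw [← ofWord_nil, addLeft_ofWord k (show IsWord n n [] from rfl), List.map_nil, ofWord_nil]

theorem isWord_singleton {P : Piece} {m n i : ℕ} (h : i + P.src ≤ m) (h' : n + P.src = m + P.tgt) :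
    IsWord m n [⟨i, P, m - (i + P.src)⟩] :=
  ⟨by simp only; omega, by simp only [IsWord]; omega⟩

/-- The bound excludes a layer too wide for `m` strands but not for `m + k`: the left side would
then be the default value `0`. Adding strands on the left creates no such room. -/
theorem addRight_gen (k : ℕ) {P : Piece} {m n i : ℕ} (h : i + P.src ≤ m) :
    Skein.addRight k (gen P m n i) = gen P (m + k) (n + k) i := by
  by_cases h' : n + P.src = m + P.tgt
  · rw [gen, addRight_ofWord k (isWord_singleton h h'),
      gen_eq_ofWord (m - (i + P.src) + k) (by omega)]
    simp [Layer.whisker]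
  · rw [gen_eq_zero (by omega), gen_eq_zero (by omega), map_zero]

theorem addLeft_gen (k : ℕ) {P : Piece} {m n i : ℕ} :
    Skein.addLeft k (gen P m n i) = gen P (k + m) (k + n) (k + i) := by
  by_cases h : i + P.src ≤ m ∧ n + P.src = m + P.tgt
  · rw [gen, addLeft_ofWord k (isWord_singleton h.1 h.2),
      gen_eq_ofWord (m - (i + P.src)) (by omega)]
    simp [Layer.whisker]
  · rw [gen_eq_zero (by omega), gen_eq_zero (by omega), map_zero]

theorem addRight_comp (k : ℕ) {m p n : ℕ} (x : Skein m p) (y : Skein p n) :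
    Skein.addRight k (Skein.comp x y) = Skein.comp (Skein.addRight k x) (Skein.addRight k y) := by
  induction x using Skein.induction with
  | hzero => simp
  | hadd x x' h h' => simp only [map_add, LinearMap.add_apply, h, h']
  | hsmul c x h => simp only [map_smul, LinearMap.smul_apply, h]
  | hd a =>
    induction y using Skein.induction with
    | hzero => simp
    | hadd x x' h h' => simp only [map_add, h, h']
    | hsmul c x h => simp only [map_smul, h]
    | hd b =>
      simp only [comp_toSkein, Skein.addRight, map_toSkein]
      congr 1
      simp [Diagram.comp, Diagram.addRight]

theorem addLeft_comp (k : ℕ) {m p n : ℕ} (x : Skein m p) (y : Skein p n) :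
    Skein.addLeft k (Skein.comp x y) = Skein.comp (Skein.addLeft k x) (Skein.addLeft k y) := by
  induction x using Skein.induction with
  | hzero => simp
  | hadd x x' h h' => simp only [map_add, LinearMap.add_apply, h, h']
  | hsmul c x h => simp only [map_smul, LinearMap.smul_apply, h]
  | hd a =>
    induction y using Skein.induction with
    | hzero => simp
    | hadd x x' h h' => simp only [map_add, h, h']
    | hsmul c x h => simp only [map_smul, h]
    | hd b =>
      simp only [comp_toSkein, Skein.addLeft, map_toSkein]
      congr 1
      simp [Diagram.comp, Diagram.addLeft]

theorem addRight_mul (k : ℕ) {n : ℕ} (x y : Skein n n) :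
    Skein.addRight k (x * y) = Skein.addRight k x * Skein.addRight k y := addRight_comp k x y

theorem addRight_addRight_one {m n : ℕ} (x : Skein m n) :
    Skein.addRight 1 (Skein.addRight 1 x) = Skein.addRight 2 x := by
  induction x using Skein.induction with
  | hzero => simp
  | hadd x x' h h' => simp only [map_add, h, h']
  | hsmul c x h => simp only [map_smul, h]
  | hd a =>
    simp only [Skein.addRight, map_toSkein]
    congr 1
    simp [Diagram.addRight, Layer.whisker, Function.comp_def, Nat.add_assoc]

/-- Elements on disjoint groups of strands can be moved past each other. -/
theorem addRight_comp_addLeft {m n k l : ℕ} (x : Skein m n) (y : Skein k l) :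
    Skein.comp (Skein.addRight k x) (Skein.addLeft n y) =
      Skein.comp (Skein.addLeft m y) (Skein.addRight l x) := by
  induction x using Skein.induction_gen with
  | hone n => rw [addRight_one, addRight_one, one_comp, comp_one]
  | hzero => simp
  | hadd m n x x' h h' => simp only [map_add, LinearMap.add_apply, h, h']
  | hsmul m n c x h => simp only [map_smul, LinearMap.smul_apply, h]
  | hgen P i r n x hx =>
    rw [addRight_comp, addRight_comp, comp_assoc, hx, ← comp_assoc, ← comp_assoc]
    congr 1
    clear hx x
    congr 1
    rw [addRight_gen _ (by omega), addRight_gen _ (by omega)]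
    -- Only one layer of `x` remains; peeling `y` in the same way reduces the claim to the
    -- interchange of two layers.
    induction y using Skein.induction_gen with
    | hone n => rw [addLeft_one, addLeft_one, one_comp, comp_one]
    | hzero => simp
    | hadd m n x x' h h' => simp only [map_add, LinearMap.add_apply, h, h']
    | hsmul m n c x h => simp only [map_smul, LinearMap.smul_apply, h]
    | hgen Q j s l y hy =>
      rw [addLeft_comp, addLeft_comp, comp_assoc, ← hy, ← comp_assoc, ← comp_assoc, addLeft_gen,
        addLeft_gen]
      congr 2
      exact gen_interchange P Q (by omega) (by omega) (by omega) (by omega)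

/-! ### Quantum integers -/

theorem A_ne_zero : A ≠ 0 := RatFunc.X_ne_zero

theorem A_pow_ne_one {k : ℕ} (hk : k ≠ 0) : A ^ k ≠ 1 := by
  intro h
  have h' : algebraMap (Polynomial ℚ) K (Polynomial.X ^ k) = algebraMap (Polynomial ℚ) K 1 := by
    rw [map_pow, RatFunc.algebraMap_X, map_one]; exact h
  have h'' := congrArg Polynomial.natDegree (RatFunc.algebraMap_injective ℚ h')
  rw [Polynomial.natDegree_X_pow, Polynomial.natDegree_one] at h''
  exact hk h''

theorem A_pow_sub_inv_ne_zero {k : ℕ} (hk : k ≠ 0) : A ^ k - A⁻¹ ^ k ≠ 0 := by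
  intro h
  refine A_pow_ne_one (k := k + k) (by omega) ?_
  rw [sub_eq_zero] at h
  rw [pow_add]
  nth_rw 2 [h]
  rw [← mul_pow, mul_inv_cancel₀ A_ne_zero, one_pow]

theorem quantumInt_ne_zero (m : ℕ) : quantumInt (m + 1) ≠ 0 :=
  div_ne_zero (A_pow_sub_inv_ne_zero (by omega)) (A_pow_sub_inv_ne_zero (by omega))

theorem quantumInt_add (a b : ℕ) :
    quantumInt (a + b) = A⁻¹ ^ (2 * a) * quantumInt b + A ^ (2 * b) * quantumInt a := by
  simp only [quantumInt]
  have h : A⁻¹ ^ (2 * a) * A ^ (2 * a) = 1 := by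
    rw [← mul_pow, inv_mul_cancel₀ A_ne_zero, one_pow]
  rw [← mul_div_assoc, ← mul_div_assoc, ← add_div]
  congr 1
  rw [mul_add, pow_add, pow_add]
  ring

theorem Delta_ne_zero (n : ℕ) : Delta n ≠ 0 :=
  mul_ne_zero (pow_ne_zero _ (by norm_num)) (quantumInt_ne_zero n)

theorem Delta_zero : Delta 0 = 1 := by
  rw [Delta, pow_zero, one_mul, zero_add, mul_one,
    div_self (A_pow_sub_inv_ne_zero (k := 2) (by omega))]

theorem Delta_one : Delta 1 = -(A ^ 2 + A⁻¹ ^ 2) := by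
  have h := A_pow_sub_inv_ne_zero (k := 2) (by omega)
  rw [Delta, pow_one, ← mul_div_assoc, div_eq_iff h]
  ring

/-- The Chebyshev recursion; it is what keeps the coefficient in `WenzlProperties.hook_mul_hook` of
the same form from one `n` to the next. -/
theorem Delta_add_two (n : ℕ) : Delta (n + 2) = -(A ^ 2 + A⁻¹ ^ 2) * Delta (n + 1) - Delta n := by
  have h : A ^ 2 * A⁻¹ ^ 2 = 1 := by
    rw [← mul_pow, mul_inv_cancel₀ A_ne_zero, one_pow]
  simp only [Delta]
  rw [← mul_div_assoc, ← mul_div_assoc, ← mul_div_assoc, ← mul_div_assoc, ← sub_div]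
  congr 1
  have e1 : A ^ (2 * (n + 2 + 1)) = A ^ (2 * (n + 1)) * (A ^ 2) * A ^ 2 := by ring
  have e2 : A ^ (2 * (n + 1 + 1)) = A ^ (2 * (n + 1)) * (A ^ 2) := by ring
  have e3 : A⁻¹ ^ (2 * (n + 2 + 1)) = A⁻¹ ^ (2 * (n + 1)) * (A⁻¹ ^ 2) * A⁻¹ ^ 2 := by ring
  have e4 : A⁻¹ ^ (2 * (n + 1 + 1)) = A⁻¹ ^ (2 * (n + 1)) * (A⁻¹ ^ 2) := by ring
  rw [e1, e2, e3, e4]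
  generalize A ^ (2 * (n + 1)) = x at *
  generalize A⁻¹ ^ (2 * (n + 1)) = y at *
  generalize A ^ 2 = a at *
  generalize A⁻¹ ^ 2 = b at *
  rw [pow_succ, pow_succ]
  linear_combination (-1) ^ n * (y - x) * h

/-! ### Jones-Wenzl idempotents -/

theorem hookAt_mul_self {m i : ℕ} (hi : i + 2 ≤ m) :
    hookAt m i * hookAt m i = Delta 1 • hookAt m i := by
  obtain ⟨p, rfl⟩ : ∃ p, m = p + 2 := ⟨m - 2, by omega⟩
  rw [mul_def, hookAt_eq rfl, comp_assoc, ← comp_assoc (gen .cap _ _ _),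
    cap_comp_cup rfl (by omega), ← Delta_one, map_smul, LinearMap.smul_apply, map_smul, one_comp]

theorem hookAt_succ_mul_hookAt_mul_hookAt_succ {m i : ℕ} (hi : i + 3 ≤ m) :
    hookAt m (i + 1) * hookAt m i * hookAt m (i + 1) = hookAt m (i + 1) := by
  obtain ⟨p, rfl⟩ : ∃ p, m = p + 2 := ⟨m - 2, by omega⟩
  simp only [mul_def]
  rw [hookAt_eq rfl, hookAt_eq rfl]
  simp only [comp_assoc]
  rw [← comp_assoc (gen .cap _ _ i), cap_comp_cup_right rfl (by omega), one_comp,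
    ← comp_assoc (gen .cap _ _ (i + 1)), cap_comp_cup_left rfl (by omega), one_comp]

theorem addRight_hookAt (k : ℕ) {m i : ℕ} (hi : i + 2 ≤ m) :
    Skein.addRight k (hookAt m i) = hookAt (m + k) i := by
  obtain ⟨p, rfl⟩ : ∃ p, m = p + 2 := ⟨m - 2, by omega⟩
  rw [hookAt_eq rfl, addRight_comp, addRight_gen k (by simpa [Piece.src] using hi),
    addRight_gen k (by simp [Piece.src]; omega), hookAt_eq (p := p + k) (by omega)]

theorem toSkein_hook (n : ℕ) : (hook n).toSkein = hookAt (n + 2) n := by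
  rw [toSkein_eq_ofWord, hookAt_eq (p := n) rfl,
    gen_comp_gen 0 0 (by simp +arith [Piece.src]) (by simp +arith [Piece.tgt])
    (by simp +arith [Piece.src])]
  rfl

theorem addRight_two_mul_hookAt {n : ℕ} (x : Skein n n) :
    Skein.addRight 2 x * hookAt (n + 2) n = hookAt (n + 2) n * Skein.addRight 2 x := by
  have e : hookAt (n + 2) n = Skein.addLeft n (hookAt 2 0) := by
    rw [hookAt_eq (p := n) rfl, hookAt_eq (p := 0) rfl, addLeft_comp, addLeft_gen, addLeft_gen]
    rfl
  rw [e]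
  exact addRight_comp_addLeft x (hookAt 2 0)

theorem jonesWenzl_add_two (n : ℕ) :
    jonesWenzl (n + 2) = Skein.addRight 1 (jonesWenzl (n + 1))
        - (Delta n / Delta (n + 1)) • (Skein.addRight 1 (jonesWenzl (n + 1)) * hookAt (n + 2) n *
            Skein.addRight 1 (jonesWenzl (n + 1))) := by
  rw [jonesWenzl, toSkein_hook]; rfl

/-- The properties of `jonesWenzl (n + 1)` that are proved together by induction. -/
structure WenzlProperties (n : ℕ) : Prop where
  mul_self : jonesWenzl (n + 1) * jonesWenzl (n + 1) = jonesWenzl (n + 1)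
  hook_mul : ∀ i, i + 2 ≤ n + 1 → hookAt (n + 1) i * jonesWenzl (n + 1) = 0
  mul_hook : ∀ i, i + 2 ≤ n + 1 → jonesWenzl (n + 1) * hookAt (n + 1) i = 0
  addRight_mul : Skein.addRight 1 (jonesWenzl n) * jonesWenzl (n + 1) = jonesWenzl (n + 1)
  mul_addRight : jonesWenzl (n + 1) * Skein.addRight 1 (jonesWenzl n) = jonesWenzl (n + 1)
  -- Closing up the last strand multiplies by `Δ_{n+1}/Δ_n`, the inverse of the coefficient in
  -- Wenzl's recursion; the new hook therefore annihilates the next idempotent.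
  hook_mul_hook : hookAt (n + 2) n * Skein.addRight 1 (jonesWenzl (n + 1)) * hookAt (n + 2) n =
    (Delta (n + 1) / Delta n) • (Skein.addRight 2 (jonesWenzl n) * hookAt (n + 2) n)

theorem wenzlProperties_zero : WenzlProperties 0 where
  mul_self := one_mul (1 : Skein 1 1)
  hook_mul := by intro i hi; omega
  mul_hook := by intro i hi; omega
  addRight_mul := by
    change Skein.addRight 1 (1 : Skein 0 0) * (1 : Skein 1 1) = 1
    rw [addRight_one]; exact one_mul _
  mul_addRight := by
    change (1 : Skein 1 1) * Skein.addRight 1 (1 : Skein 0 0) = 1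
    rw [addRight_one]; exact one_mul _
  hook_mul_hook := by
    change hookAt 2 0 * Skein.addRight 1 (1 : Skein 1 1) * hookAt 2 0 =
      (Delta 1 / Delta 0) • ((Skein.addRight 2 (1 : Skein 0 0) : Skein 2 2) * hookAt 2 0)
    rw [addRight_one, addRight_one, mul_one, hookAt_mul_self (by omega), Delta_zero, div_one]
    congr 1
    exact (one_mul _).symm

theorem wenzlProperties_succ {n : ℕ} (h : WenzlProperties n) : WenzlProperties (n + 1) := by
  have hd := Delta_ne_zero n
  have hd' := Delta_ne_zero (n + 1)
  have hf := jonesWenzl_add_two n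
  have hFF : Skein.addRight 1 (jonesWenzl (n + 1)) * Skein.addRight 1 (jonesWenzl (n + 1)) =
      Skein.addRight 1 (jonesWenzl (n + 1)) := by
    rw [← addRight_mul, h.mul_self]
  have hGF : Skein.addRight 2 (jonesWenzl n) * Skein.addRight 1 (jonesWenzl (n + 1)) =
      Skein.addRight 1 (jonesWenzl (n + 1)) := by
    rw [← addRight_addRight_one, ← addRight_mul, h.addRight_mul]
  have hFG : Skein.addRight 1 (jonesWenzl (n + 1)) * Skein.addRight 2 (jonesWenzl n) =
      Skein.addRight 1 (jonesWenzl (n + 1)) := by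
    rw [← addRight_addRight_one, ← addRight_mul, h.mul_addRight]
  have hGe := addRight_two_mul_hookAt (jonesWenzl n)
  have heFe := h.hook_mul_hook
  have hleft : ∀ i, i + 2 ≤ n + 2 → hookAt (n + 2) i * jonesWenzl (n + 2) = 0 := by
    intro i hi
    rw [hf]
    rcases Nat.lt_or_ge i n with hin | hin
    · have e : hookAt (n + 2) i * Skein.addRight 1 (jonesWenzl (n + 1)) = 0 := by
        rw [← addRight_hookAt 1 (m := n + 1) (by omega), ← addRight_mul, h.hook_mul i (by omega),
          map_zero]
      rw [mul_sub, mul_smul_comm, ← mul_assoc, ← mul_assoc, e, zero_mul, zero_mul, smul_zero,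
        sub_zero]
    -- With `F = f^{(n+1)} ⊗ 1` and `e` the last hook, `e F e` cancels the Wenzl coefficient and
    -- leaves `f^{(n)} ⊗ 1₂` times `e`. This commutes past `e` and is absorbed by `F`, so the
    -- difference is `e F - e F`.
    · obtain rfl : i = n := by omega
      rw [mul_sub, mul_smul_comm, ← mul_assoc, ← mul_assoc, heFe, smul_mul_assoc, smul_smul,
        div_mul_div_cancel₀ hd', div_self hd, one_smul, hGe, mul_assoc, hGF, sub_self]
  have hright : ∀ i, i + 2 ≤ n + 2 → jonesWenzl (n + 2) * hookAt (n + 2) i = 0 := by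
    intro i hi
    rw [hf]
    rcases Nat.lt_or_ge i n with hin | hin
    · have e : Skein.addRight 1 (jonesWenzl (n + 1)) * hookAt (n + 2) i = 0 := by
        rw [← addRight_hookAt 1 (m := n + 1) (by omega), ← addRight_mul, h.mul_hook i (by omega),
          map_zero]
      rw [sub_mul, smul_mul_assoc, mul_assoc, e, mul_zero, smul_zero, sub_zero]
    · obtain rfl : i = n := by omega
      rw [sub_mul, smul_mul_assoc, mul_assoc, mul_assoc, ← mul_assoc (hookAt _ _), heFe,
        mul_smul_comm, smul_smul, div_mul_div_cancel₀ hd', div_self hd, one_smul, ← mul_assoc, hFG,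
        sub_self]
  have hFf : Skein.addRight 1 (jonesWenzl (n + 1)) * jonesWenzl (n + 2) = jonesWenzl (n + 2) := by
    rw [hf, mul_sub, mul_smul_comm, ← mul_assoc, ← mul_assoc, hFF]
  have hfF : jonesWenzl (n + 2) * Skein.addRight 1 (jonesWenzl (n + 1)) = jonesWenzl (n + 2) := by
    rw [hf, sub_mul, smul_mul_assoc, mul_assoc, hFF]
  refine ⟨?_, hleft, hright, hFf, hfF, ?_⟩
  · change jonesWenzl (n + 2) * jonesWenzl (n + 2) = jonesWenzl (n + 2)
    nth_rw 1 [hf]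
    rw [sub_mul, smul_mul_assoc, mul_assoc, hFf, mul_assoc, hleft n le_rfl, mul_zero, smul_zero,
      sub_zero]
  · have hc := addRight_two_mul_hookAt (jonesWenzl (n + 1))
    have hFF' : Skein.addRight 2 (jonesWenzl (n + 1)) * Skein.addRight 2 (jonesWenzl (n + 1)) =
        Skein.addRight 2 (jonesWenzl (n + 1)) := by
      rw [← addRight_mul, h.mul_self]
    have e : Skein.addRight 1 (jonesWenzl (n + 2)) = Skein.addRight 2 (jonesWenzl (n + 1)) -
        (Delta n / Delta (n + 1)) • (Skein.addRight 2 (jonesWenzl (n + 1)) * hookAt (n + 3) n *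
            Skein.addRight 2 (jonesWenzl (n + 1))) := by
      rw [hf, map_sub, map_smul, addRight_mul, addRight_mul, addRight_hookAt 1 (by omega),
        addRight_addRight_one]
    change hookAt (n + 3) (n + 1) * Skein.addRight 1 (jonesWenzl (n + 2)) * hookAt (n + 3) (n + 1) =
      _ • (Skein.addRight 2 (jonesWenzl (n + 1)) * hookAt (n + 3) (n + 1))
    change Skein.addRight 2 (jonesWenzl (n + 1)) * hookAt (n + 3) (n + 1) =
      hookAt (n + 3) (n + 1) * Skein.addRight 2 (jonesWenzl (n + 1)) at hc
    have hee := hookAt_mul_self (m := n + 3) (i := n + 1) (by omega)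
    have hefe := hookAt_succ_mul_hookAt_mul_hookAt_succ (m := n + 3) (i := n) (by omega)
    have hD := Delta_add_two n
    rw [← Delta_one] at hD
    rw [e]
    generalize (Skein.addRight 2 (jonesWenzl (n + 1)) : Skein (n + 3) (n + 3)) = F at *
    generalize hookAt (n + 3) (n + 1) = e2 at *
    generalize hookAt (n + 3) n = e1 at *
    -- `F` acts on the strands to the left of `e2`, so it commutes with `e2`. Being idempotent, it
    -- gathers outside `e2 * e1 * e2 = e2`.
    have e3 : e2 * (F * e1 * F) * e2 = F * e2 := by
      calc e2 * (F * e1 * F) * e2 = (e2 * F) * e1 * (F * e2) := by simp only [mul_assoc]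
        _ = F * (e2 * e1 * e2) * F := by rw [hc, ← hc]; simp only [mul_assoc]; rw [hc]
        _ = F * e2 := by rw [hefe, mul_assoc, ← hc, ← mul_assoc, hFF']
    rw [mul_sub, sub_mul, mul_smul_comm, smul_mul_assoc, e3, ← hc, mul_assoc, hee, mul_smul_comm,
      ← sub_smul]
    congr 1
    rw [hD, sub_div, mul_div_cancel_right₀ _ hd']

theorem wenzlProperties (n : ℕ) : WenzlProperties n := by
  induction n with
  | zero => exact wenzlProperties_zero
  | succ n ih => exact wenzlProperties_succ ih

/-- Following the cup by a cap and a cup again only creates a circle, of nonzero value `Δ_1`, so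
annihilation of the hook implies annihilation of the cup. -/
theorem jonesWenzl_comp_cup {n p i : ℕ} (hi : i + 2 ≤ n) :
    Skein.comp (jonesWenzl n) (gen .cup n p i) = 0 := by
  obtain ⟨n, rfl⟩ : ∃ k, n = k + 1 := ⟨n - 1, by omega⟩
  by_cases hp : n + 1 = p + 2
  · have e : Skein.comp (jonesWenzl (n + 1) * hookAt (n + 1) i) (gen .cup (n + 1) p i) =
        Delta 1 • Skein.comp (jonesWenzl (n + 1)) (gen .cup (n + 1) p i) := by
      rw [mul_comp, hookAt_eq hp, comp_assoc, cap_comp_cup hp (by omega), ← Delta_one, map_smul,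
        map_smul, comp_one]
    rw [(wenzlProperties n).mul_hook i hi, map_zero, LinearMap.zero_apply] at e
    exact (smul_eq_zero.1 e.symm).resolve_left (Delta_ne_zero 1)
  · rw [gen_eq_zero (by simp only [Piece.src, Piece.tgt]; omega), map_zero]

theorem cap_comp_jonesWenzl {n p i : ℕ} (hi : i + 2 ≤ n) :
    Skein.comp (gen .cap p n i) (jonesWenzl n) = 0 := by
  obtain ⟨n, rfl⟩ : ∃ k, n = k + 1 := ⟨n - 1, by omega⟩
  by_cases hp : n + 1 = p + 2
  · have e : Skein.comp (gen .cap p (n + 1) i) (hookAt (n + 1) i * jonesWenzl (n + 1)) =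
        Delta 1 • Skein.comp (gen .cap p (n + 1) i) (jonesWenzl (n + 1)) := by
      rw [comp_mul, hookAt_eq hp, ← comp_assoc, cap_comp_cup hp (by omega), ← Delta_one, map_smul,
        LinearMap.smul_apply, one_comp, map_smul, LinearMap.smul_apply]
    rw [(wenzlProperties n).hook_mul i hi, map_zero] at e
    exact (smul_eq_zero.1 e.symm).resolve_left (Delta_ne_zero 1)
  · rw [gen_eq_zero (by simp only [Piece.src, Piece.tgt]; omega), map_zero, LinearMap.zero_apply]

/-! ### Turnbacks -/

/-- The only position not covered is `i = n - 1`, where the arc joins the two groups. Indices beyond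
the last strand give the zero generator. -/
theorem tensor_jonesWenzl_comp_cup {n p i : ℕ} (hi : i + 2 ≤ n ∨ n ≤ i) :
    Skein.comp (Skein.tensor (jonesWenzl n) (jonesWenzl n)) (gen .cup (n + n) p i) = 0 := by
  by_cases hp : i + 2 ≤ n + n ∧ n + n = p + 2
  · rw [Skein.tensor]
    rcases hi with hi | hi
    · obtain rfl : p = n - 2 + n := by omega
      have h := addRight_gen n (P := .cup) (m := n) (n := n - 2) (i := i)
        (by simpa only [Piece.src] using hi)
      rw [addRight_comp_addLeft, comp_assoc, ← h, ← addRight_comp, jonesWenzl_comp_cup hi, map_zero,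
        map_zero]
    · obtain rfl : p = n + (n - 2) := by omega
      obtain ⟨j, rfl⟩ := Nat.exists_eq_add_of_le hi
      have h := addLeft_gen n (P := .cup) (m := n) (n := n - 2) (i := j)
      rw [comp_assoc, ← h, ← addLeft_comp, jonesWenzl_comp_cup (by omega), map_zero, map_zero]
  · rw [gen_eq_zero (by simp only [Piece.src, Piece.tgt]; omega), map_zero]

theorem cap_comp_tensor_jonesWenzl {n p i : ℕ} (hi : i + 2 ≤ n ∨ n ≤ i) :
    Skein.comp (gen .cap p (n + n) i) (Skein.tensor (jonesWenzl n) (jonesWenzl n)) = 0 := by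
  by_cases hp : i + 2 ≤ n + n ∧ n + n = p + 2
  · rw [Skein.tensor]
    rcases hi with hi | hi
    · obtain rfl : p = n - 2 + n := by omega
      have h := addRight_gen n (P := .cap) (m := n - 2) (n := n) (i := i)
        (by simp only [Piece.src]; omega)
      rw [← comp_assoc, ← h, ← addRight_comp, cap_comp_jonesWenzl hi, map_zero, map_zero,
        LinearMap.zero_apply]
    · obtain rfl : p = n + (n - 2) := by omega
      obtain ⟨j, rfl⟩ := Nat.exists_eq_add_of_le hi
      have h := addLeft_gen n (P := .cap) (m := n - 2) (n := n) (i := j)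
      rw [addRight_comp_addLeft, ← comp_assoc, ← h, ← addLeft_comp, cap_comp_jonesWenzl (by omega),
        map_zero, map_zero, LinearMap.zero_apply]
  · rw [gen_eq_zero (by simp only [Piece.src, Piece.tgt]; omega), map_zero, LinearMap.zero_apply]

/-- The elements with a cup joining two points of the same group on the top edge, or a cap joining
two points of the same group on the bottom edge, for the four groups of `n` points. -/
def turnback (n : ℕ) : Submodule K (Skein (n + n) (n + n)) :=
  Submodule.span K
    ({x | ∃ (p i : ℕ) (y : Skein p (n + n)), (i + 2 ≤ n ∨ n ≤ i) ∧
        x = Skein.comp (gen .cup (n + n) p i) y} ∪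
      {x | ∃ (p i : ℕ) (y : Skein (n + n) p), (i + 2 ≤ n ∨ n ≤ i) ∧
        x = Skein.comp y (gen .cap p (n + n) i)})

theorem cup_comp_mem_turnback {n p i : ℕ} (hi : i + 2 ≤ n ∨ n ≤ i) (y : Skein p (n + n)) :
    Skein.comp (gen .cup (n + n) p i) y ∈ turnback n :=
  Submodule.subset_span (Or.inl ⟨p, i, y, hi, rfl⟩)

theorem comp_cap_mem_turnback {n p i : ℕ} (hi : i + 2 ≤ n ∨ n ≤ i) (y : Skein (n + n) p) :
    Skein.comp y (gen .cap p (n + n) i) ∈ turnback n :=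
  Submodule.subset_span (Or.inr ⟨p, i, y, hi, rfl⟩)

theorem turnback_le {n : ℕ} {U : Submodule K (Skein (n + n) (n + n))}
    (hcup : ∀ (p i : ℕ) (y : Skein p (n + n)), (i + 2 ≤ n ∨ n ≤ i) → i + 2 ≤ n + n →
      n + n = p + 2 → Skein.comp (gen .cup (n + n) p i) y ∈ U)
    (hcap : ∀ (p i : ℕ) (y : Skein (n + n) p), (i + 2 ≤ n ∨ n ≤ i) → i + 2 ≤ n + n →
      n + n = p + 2 → Skein.comp y (gen .cap p (n + n) i) ∈ U) :
    turnback n ≤ U := by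
  refine Submodule.span_le.2 ?_
  rintro _ (⟨p, i, y, hi, rfl⟩ | ⟨p, i, y, hi, rfl⟩)
  · by_cases h : i + 2 ≤ n + n ∧ n + n = p + 2
    · exact hcup p i y hi h.1 h.2
    · rw [gen_eq_zero (by simp only [Piece.src, Piece.tgt]; omega), map_zero, LinearMap.zero_apply]
      exact U.zero_mem
  · by_cases h : i + 2 ≤ n + n ∧ n + n = p + 2
    · exact hcap p i y hi h.1 h.2
    · rw [gen_eq_zero (by simp only [Piece.src, Piece.tgt]; omega), map_zero]
      exact U.zero_mem

/-- Decorate each of the four groups of endpoints with a Jones-Wenzl idempotent. -/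
def decorateMap (n : ℕ) : Skein (n + n) (n + n) →ₗ[K] Skein (n + n) (n + n) :=
  Skein.comp.flip (Skein.tensor (jonesWenzl n) (jonesWenzl n)) ∘ₗ
    Skein.comp (Skein.tensor (jonesWenzl n) (jonesWenzl n))

theorem turnback_le_ker_decorateMap (n : ℕ) : turnback n ≤ LinearMap.ker (decorateMap n) := by
  refine turnback_le (fun p i y hi _ _ => ?_) (fun p i y hi _ _ => ?_)
  · rw [LinearMap.mem_ker, decorateMap, LinearMap.comp_apply, ← comp_assoc,
      tensor_jonesWenzl_comp_cup hi, map_zero, LinearMap.zero_apply, map_zero]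
  · rw [LinearMap.mem_ker, decorateMap, LinearMap.comp_apply, LinearMap.flip_apply, comp_assoc,
      comp_assoc, cap_comp_tensor_jonesWenzl hi, map_zero, map_zero]

theorem mkQ_hookAt_mul {n i : ℕ} (hi : i + 2 ≤ n ∨ n ≤ i) (x : Skein (n + n) (n + n)) :
    (turnback n).mkQ (hookAt (n + n) i * x) = 0 := by
  rw [Submodule.mkQ_apply, Submodule.Quotient.mk_eq_zero, mul_def, hookAt, comp_assoc]
  exact cup_comp_mem_turnback hi _

theorem mkQ_mul_hookAt {n i : ℕ} (hi : i + 2 ≤ n ∨ n ≤ i) (x : Skein (n + n) (n + n)) :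
    (turnback n).mkQ (x * hookAt (n + n) i) = 0 := by
  rw [Submodule.mkQ_apply, Submodule.Quotient.mk_eq_zero, mul_def, hookAt, ← comp_assoc]
  exact comp_cap_mem_turnback hi _

/-- The hook smoothing is a turnback, so only the identity smoothing survives. -/
theorem mkQ_over_mul {n i : ℕ} (hi : i + 2 ≤ n ∨ n ≤ i) (hi' : i + 2 ≤ n + n)
    (x : Skein (n + n) (n + n)) :
    (turnback n).mkQ (gen .over (n + n) (n + n) i * x) = A⁻¹ • (turnback n).mkQ x := by
  rw [over_eq hi', add_mul, smul_mul_assoc, smul_mul_assoc, one_mul, map_add, map_smul, map_smul,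
    mkQ_hookAt_mul hi, smul_zero, zero_add]

theorem mkQ_mul_under {n i : ℕ} (hi : i + 2 ≤ n ∨ n ≤ i) (hi' : i + 2 ≤ n + n)
    (x : Skein (n + n) (n + n)) :
    (turnback n).mkQ (x * gen .under (n + n) (n + n) i) = A • (turnback n).mkQ x := by
  rw [under_eq hi', mul_add, mul_smul_comm, mul_smul_comm, mul_one, map_add, map_smul, map_smul,
    mkQ_mul_hookAt hi, smul_zero, add_zero]

/-! ### Products of crossings -/

section Products

variable {R : Type*} [Monoid R]

/-- `g i * g (i + 1) * ⋯ * g (i + a - 1)`. -/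
def upProd (g : ℕ → R) : ℕ → ℕ → R
  | _, 0 => 1
  | i, a + 1 => g i * upProd g (i + 1) a

/-- `g (i + a - 1) * ⋯ * g (i + 1) * g i`. -/
def downProd (g : ℕ → R) (i : ℕ) : ℕ → R
  | 0 => 1
  | a + 1 => g (i + a) * downProd g i a

/-- The product of crossings along a grid with rows of length `n`, in the order of `crossWord`. -/
def gridProd (g : ℕ → R) (n : ℕ) : ℕ → ℕ → R
  | _, 0 => 1
  | i, t + 1 => downProd g i n * gridProd g n (i + 1) t

theorem upProd_succ (g : ℕ → R) (i a : ℕ) : upProd g i (a + 1) = g i * upProd g (i + 1) a := rfl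

theorem downProd_succ (g : ℕ → R) (i a : ℕ) :
    downProd g i (a + 1) = g (i + a) * downProd g i a := rfl

theorem upProd_succ' (g : ℕ → R) (i a : ℕ) : upProd g i (a + 1) = upProd g i a * g (i + a) := by
  induction a generalizing i with
  | zero => simp [upProd]
  | succ a ih =>
    rw [upProd_succ, ih (i + 1), ← mul_assoc, ← upProd_succ, Nat.add_right_comm, Nat.add_assoc]

theorem downProd_succ' (g : ℕ → R) (i a : ℕ) :
    downProd g i (a + 1) = downProd g (i + 1) a * g i := by
  induction a with
  | zero => simp [downProd]
  | succ a ih =>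
    rw [downProd_succ, ih, ← mul_assoc, downProd_succ g (i + 1), Nat.add_right_comm i 1 a,
      Nat.add_assoc]

theorem commute_upProd {x : R} {g : ℕ → R} {i a : ℕ}
    (h : ∀ k, i ≤ k → k < i + a → Commute x (g k)) : Commute x (upProd g i a) := by
  induction a generalizing i with
  | zero => exact Commute.one_right x
  | succ a ih =>
    exact (h i le_rfl (by omega)).mul_right (ih fun k hk hk' => h k (by omega) (by omega))

theorem commute_downProd {x : R} {g : ℕ → R} {i a : ℕ}
    (h : ∀ k, i ≤ k → k < i + a → Commute x (g k)) : Commute x (downProd g i a) := by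
  induction a with
  | zero => exact Commute.one_right x
  | succ a ih =>
    exact (h (i + a) (by omega) (by omega)).mul_right (ih fun k hk hk' => h k hk (by omega))

theorem commute_gridProd {x : R} {g : ℕ → R} {n i t : ℕ}
    (h : ∀ k, i ≤ k → Commute x (g k)) : Commute x (gridProd g n i t) := by
  induction t generalizing i with
  | zero => exact Commute.one_right x
  | succ t ih =>
    exact (commute_downProd fun k hk _ => h k hk).mul_right (ih fun k hk => h k (by omega))

/-- Split off the last strand of the overcrossing band. -/
theorem gridProd_succ {g : ℕ → R} (hg : ∀ i j, i + 2 ≤ j → Commute (g i) (g j)) (n i t : ℕ) :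
    gridProd g (n + 1) i t = upProd g (i + n) t * gridProd g n i t := by
  induction t generalizing i with
  | zero => simp [gridProd, upProd]
  | succ t ih =>
    have hc : Commute (upProd g (i + n + 1) t) (downProd g i n) :=
      commute_downProd fun k _ hk =>
        (commute_upProd fun j hj _ => hg k j (by omega)).symm
    rw [gridProd, gridProd, upProd, downProd, ih, Nat.add_right_comm i 1 n]
    simp only [mul_assoc]
    rw [← mul_assoc (downProd g i n), ← hc.eq, mul_assoc]

variable {g u : ℕ → R} (hg : ∀ i j, i + 2 ≤ j → Commute (g i) (g j))
  (hgu : ∀ i j, i + 2 ≤ j → Commute (g i) (u j)) (hug : ∀ i j, i + 2 ≤ j → Commute (u i) (g j))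
  (hb : ∀ i, u i * (g (i + 1) * g i) = g (i + 1) * g i * u (i + 1))
include hgu hug hb

/-- Two strands pass under the same `n` strands, and their mutual crossing is moved from one side of
these to the other, by `n` uses of `hb`. The isolated factor `g i` is that crossing. -/
theorem upProd_mul_downProd (n i : ℕ) :
    upProd u i n * downProd g i (n + 1) = downProd g (i + 1) n * g i * upProd u (i + 1) n := by
  induction n with
  | zero => simp [upProd, downProd]
  | succ n ih =>
    have h1 : Commute (u (i + n + 1)) (downProd g i n) :=
      commute_downProd fun k _ hk => (hgu k _ (by omega)).symm
    have h2 : Commute (upProd u i n) (g (i + n + 1)) :=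
      (commute_upProd fun k _ hk => (hug k _ (by omega)).symm).symm
    calc upProd u i (n + 1) * downProd g i (n + 1 + 1)
        = upProd u i n * (u (i + n) * (g (i + n + 1) * g (i + n))) * downProd g i n := by
          rw [upProd_succ', downProd, downProd]; simp only [mul_assoc, Nat.add_assoc]
      _ = g (i + n + 1) * (upProd u i n * (g (i + n) * downProd g i n)) * u (i + n + 1) := by
          rw [hb]
          simp only [mul_assoc]
          rw [← h1.eq, ← mul_assoc, h2.eq, mul_assoc]
      _ = downProd g (i + 1) (n + 1) * g i * upProd u (i + 1) (n + 1) := by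
          rw [← downProd_succ, ih, upProd_succ', downProd, Nat.add_right_comm i 1 n]
          simp only [mul_assoc]

include hg in
/-- A strand that passes under one band and over another can be moved past their crossing. -/
theorem upProd_mul_gridProd (n i t : ℕ) :
    upProd u i n * (upProd g (i + n) t * gridProd g n i t) =
      gridProd g n (i + 1) t * (upProd g i t * upProd u (i + t) n) := by
  induction t generalizing i with
  | zero => simp [gridProd, upProd]
  | succ t ih =>
    have h1 : Commute (upProd g (i + n + 1) t) (downProd g i n) :=
      commute_downProd fun k _ hk => (commute_upProd fun j hj _ => hg k j (by omega)).symm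
    have h2 : Commute (g i) (gridProd g n (i + 2) t) := commute_gridProd fun k hk => hg i k hk
    -- One strand of the undercrossing band is treated at a time: its row `downProd g i n`, with its
    -- crossing `g (i + n)` with the moving strand, forms the row of length `n + 1` in
    -- `upProd_mul_downProd`.
    calc upProd u i n * (upProd g (i + n) (t + 1) * gridProd g n i (t + 1))
        = upProd u i n * downProd g i (n + 1) *
            (upProd g (i + n + 1) t * gridProd g n (i + 1) t) := by
          rw [upProd, gridProd, downProd]
          simp only [mul_assoc]
          rw [← mul_assoc (upProd g _ t), h1.eq, mul_assoc]
      _ = downProd g (i + 1) n * g i * (upProd u (i + 1) n *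
            (upProd g (i + 1 + n) t * gridProd g n (i + 1) t)) := by
          rw [upProd_mul_downProd hgu hug hb, Nat.add_right_comm i 1 n]
          simp only [mul_assoc]
      _ = _ := by
          rw [ih, gridProd, upProd, ← mul_assoc, mul_assoc (downProd _ _ _), h2.eq]
          simp only [mul_assoc, Nat.add_assoc, Nat.add_comm 1 t]

end Products

/-! ### Sliding arcs through rows of crossings. -/

theorem commute_crossings (m : ℕ) {P Q : Piece} (hP : P.src = 2 ∧ P.tgt = 2)
    (hQ : Q.src = 2 ∧ Q.tgt = 2) (i j : ℕ) (h : i + 2 ≤ j) :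
    Commute (gen P m m i) (gen Q m m j) :=
  gen_interchange P Q (by omega) (by omega) (by omega) (by omega)

/-- The arc's left leg runs under `a` strands to its left. Moving the maximum under these strands
makes the right leg run back under them instead, one slide move per strand. -/
theorem cap_comp_downProd_over {m p : ℕ} (hp : p = m + 2) (i a : ℕ) :
    Skein.comp (gen .cap m p (i + a)) (downProd (gen .over p p) i a) =
      Skein.comp (gen .cap m p i) (upProd (gen .under p p) (i + 1) a) := by
  induction a with
  | zero => rfl
  | succ a ih =>
    have hc : Commute (gen .under p p (i + a + 1)) (downProd (gen .over p p) i a) :=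
      commute_downProd fun k _ hk =>
        (commute_crossings p ⟨rfl, rfl⟩ ⟨rfl, rfl⟩ k _ (by omega)).symm
    rw [downProd, comp_mul, ← Nat.add_assoc, cap_succ_comp_over hp, ← comp_mul, hc.eq, comp_mul, ih,
      ← comp_mul, upProd_succ', Nat.add_right_comm]

/-- The mirror situation: the right leg runs over `a` strands, and the maximum is moved to the right
over them. -/
theorem cap_comp_upProd_over {m p : ℕ} (hp : p = m + 2) (i a : ℕ) :
    Skein.comp (gen .cap m p i) (upProd (gen .over p p) (i + 1) a) =
      Skein.comp (gen .cap m p (i + a)) (downProd (gen .under p p) i a) := by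
  induction a generalizing i with
  | zero => rfl
  | succ a ih =>
    have hc : Commute (gen .under p p i) (upProd (gen .over p p) (i + 1 + 1) a) :=
      commute_upProd fun k hk _ => commute_crossings p ⟨rfl, rfl⟩ ⟨rfl, rfl⟩ i k hk
    rw [upProd, comp_mul, cap_comp_over_succ hp, ← comp_mul, hc.eq, comp_mul, ih, ← comp_mul,
      downProd_succ', Nat.add_right_comm, Nat.add_assoc]

/-- The arc lies to the left of all the crossings; passing it only shifts their positions by its two
endpoints. -/
theorem cap_comp_gridProd {m p : ℕ} (hp : p = m + 2) (n i t : ℕ) :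
    Skein.comp (gen .cap m p 0) (gridProd (gen .over p p) n (i + 2) t) =
      Skein.comp (gridProd (gen .over m m) n i t) (gen .cap m p 0) := by
  have h0 : ∀ j, Skein.comp (gen .cap m p 0) (gen .over p p (j + 2)) =
      Skein.comp (gen .over m m j) (gen .cap m p 0) := fun j =>
    gen_interchange .cap .over (by simp only [Piece.src, Piece.tgt]; omega) rfl
      (by simp only [Piece.src]; omega) rfl
  have h1 : ∀ j a, Skein.comp (gen .cap m p 0) (downProd (gen .over p p) (j + 2) a) =
      Skein.comp (downProd (gen .over m m) j a) (gen .cap m p 0) := by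
    intro j a
    induction a with
    | zero => exact (comp_one _).trans (one_comp _).symm
    | succ a ih => rw [downProd, downProd, comp_mul, mul_comp, ← ih, Nat.add_right_comm, h0,
        comp_assoc]
  induction t generalizing i with
  | zero => exact (comp_one _).trans (one_comp _).symm
  | succ t ih => rw [gridProd, gridProd, comp_mul, mul_comp, ← ih, h1, comp_assoc,
      Nat.add_right_comm]

/-! ### The band crossing as a product of generators. -/

theorem ofWord_passWord_append {m i s n : ℕ} (hm : m = i + n + 1 + s) (w : List Layer) :
    ofWord m m (passWord i s n ++ w) = downProd (gen .over m m) i n * ofWord m m w := by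
  induction n generalizing s with
  | zero => exact (one_mul _).symm
  | succ n ih =>
    rw [downProd, mul_assoc, ← ih (s := s + 1) (by omega), mul_def,
      gen_comp_ofWord (r := s) (by simp only [Piece.src]; omega) (by simp only [Piece.tgt]; omega)]
    rfl

theorem ofWord_crossWord {m n i t : ℕ} (hm : m = i + n + t) :
    ofWord m m (crossWord n i t) = gridProd (gen .over m m) n i t := by
  induction t generalizing i with
  | zero => exact ofWord_nil m
  | succ t ih => rw [crossWord, gridProd, ofWord_passWord_append (by omega), ih (by omega)]

theorem toSkein_bandCrossing (n : ℕ) :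
    (bandCrossing n).toSkein = gridProd (gen .over (n + n) (n + n)) n 0 n := by
  rw [toSkein_eq_ofWord, ← ofWord_crossWord (by omega)]
  rfl

/-! ### Adding a vertical strand on either side -/

/-- Add one vertical strand on the left and one on the right. -/
def Diagram.widen {m n m' n' : ℕ} (hm : m' = m + 2) (hn : n' = n + 2) (a : Diagram m n) :
    Diagram m' n' :=
  ⟨a.word.map (Layer.whisker 1 1), by
    have h := a.valid.whisker 1 1
    rwa [show 1 + m + 1 = m' by omega, show 1 + n + 1 = n' by omega] at h⟩

theorem surround_widen {m n m' n' : ℕ} (hm : m' = m + 2) (hn : n' = n + 2) (p q : ℕ)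
    (S : Surround p q m n) :
    ∃ T : Surround p q m' n', ∀ u, (S.fill u).widen hm hn = T.fill u := by
  refine ⟨⟨1 + S.left, S.right + 1, ⟨S.above.word.map (Layer.whisker 1 1), ?_⟩,
    ⟨S.below.word.map (Layer.whisker 1 1), ?_⟩⟩, fun u => ?_⟩
  · have h := S.above.valid.whisker 1 1
    rwa [show 1 + m + 1 = m' by omega, show 1 + (S.left + p + S.right) + 1 =
      1 + S.left + p + (S.right + 1) by omega] at h
  · have h := S.below.valid.whisker 1 1
    rwa [show 1 + n + 1 = n' by omega, show 1 + (S.left + q + S.right) + 1 =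
      1 + S.left + q + (S.right + 1) by omega] at h
  · ext1
    simp [Diagram.comp, Surround.fill, Diagram.widen, Diagram.whisker, Layer.whisker, Nat.add_assoc]

/-- Add one vertical strand on the left and one on the right of a skein element. -/
def Skein.widen {m n m' n' : ℕ} (hm : m' = m + 2) (hn : n' = n + 2) :
    Skein m n →ₗ[K] Skein m' n' :=
  Skein.map (Diagram.widen hm hn) (surround_widen hm hn)

theorem widen_ofWord {m n m' n' : ℕ} (hm : m' = m + 2) (hn : n' = n + 2) {w : List Layer}
    (h : IsWord m n w) :
    Skein.widen hm hn (ofWord m n w) = ofWord m' n' (w.map (Layer.whisker 1 1)) := by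
  rw [ofWord, dif_pos h, Skein.widen, map_toSkein, toSkein_eq_ofWord]
  rfl

theorem widen_comp {m p n m' p' n' : ℕ} (hm : m' = m + 2) (hp : p' = p + 2) (hn : n' = n + 2)
    (x : Skein m p) (y : Skein p n) :
    Skein.widen hm hn (Skein.comp x y) =
      Skein.comp (Skein.widen hm hp x) (Skein.widen hp hn y) := by
  induction x using Skein.induction with
  | hzero => simp
  | hadd x x' h h' => simp only [map_add, LinearMap.add_apply, h, h']
  | hsmul c x h => simp only [map_smul, LinearMap.smul_apply, h]
  | hd a =>
    induction y using Skein.induction with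
    | hzero => simp
    | hadd x x' h h' => simp only [map_add, h, h']
    | hsmul c x h => simp only [map_smul, h]
    | hd b =>
      simp only [comp_toSkein, Skein.widen, map_toSkein]
      congr 1
      simp [Diagram.comp, Diagram.widen]

theorem widen_one {m m' : ℕ} (hm : m' = m + 2) : Skein.widen hm hm (1 : Skein m m) = 1 := by
  rw [← ofWord_nil, widen_ofWord hm hm (show IsWord m m [] from rfl), List.map_nil, ofWord_nil]

theorem widen_gen {P : Piece} {m n m' n' i : ℕ} (hm : m' = m + 2) (hn : n' = n + 2)
    (h : i + P.src ≤ m) : Skein.widen hm hn (gen P m n i) = gen P m' n' (i + 1) := by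
  by_cases h' : n + P.src = m + P.tgt
  · rw [gen, widen_ofWord hm hn (isWord_singleton h h'),
      gen_eq_ofWord (m - (i + P.src) + 1) (by omega)]
    simp [Layer.whisker, Nat.add_comm]
  · rw [gen_eq_zero (by omega), gen_eq_zero (by omega), map_zero]

theorem widen_gridProd {m m' : ℕ} (hm : m' = m + 2) {n i t : ℕ} (h : i + n + t ≤ m) :
    Skein.widen hm hm (gridProd (gen .over m m) n i t) =
      gridProd (gen .over m' m') n (i + 1) t := by
  have h1 : ∀ j a, j + a + 1 ≤ m → Skein.widen hm hm (downProd (gen .over m m) j a) =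
      downProd (gen .over m' m') (j + 1) a := by
    intro j a hj
    induction a with
    | zero => exact widen_one hm
    | succ a ih =>
      rw [downProd, downProd, mul_def, widen_comp hm hm hm,
        widen_gen hm hm (by simp only [Piece.src]; omega), ih (by omega), Nat.add_right_comm]
      rfl
  induction t generalizing i with
  | zero => exact widen_one hm
  | succ t ih =>
    rw [gridProd, gridProd, mul_def, widen_comp hm hm hm, h1 _ _ (by omega), ih (by omega)]
    rfl

theorem succ_add_succ_eq (n : ℕ) : n + 1 + (n + 1) = n + n + 2 := by omega

/-- `Skein.widen` on `n + n` strands. -/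
def sides (n : ℕ) : Skein (n + n) (n + n) →ₗ[K] Skein (n + 1 + (n + 1)) (n + 1 + (n + 1)) :=
  Skein.widen (succ_add_succ_eq n) (succ_add_succ_eq n)

/-- Add an outermost cup above and an outermost cap below. -/
def arcs (n : ℕ) : Skein (n + n) (n + n) →ₗ[K] Skein (n + 1 + (n + 1)) (n + 1 + (n + 1)) :=
  Skein.comp (gen .cup _ _ n) ∘ₗ Skein.comp.flip (gen .cap _ _ n)

theorem arcs_apply (n : ℕ) (x : Skein (n + n) (n + n)) :
    arcs n x = Skein.comp (gen .cup _ _ n) (Skein.comp x (gen .cap _ _ n)) := rfl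

/-- Position `i` becomes `i + 1` while each group grows by an outermost strand, so the arc stays
within its group. -/
theorem turnback_le_comap_sides (n : ℕ) : turnback n ≤ (turnback (n + 1)).comap (sides n) := by
  refine turnback_le (fun p i y hi h h' => ?_) (fun p i y hi h h' => ?_)
  · rw [Submodule.mem_comap, sides, widen_comp (p' := p + 2) _ rfl,
      widen_gen _ _ (by simpa only [Piece.src] using h)]
    exact cup_comp_mem_turnback (by omega) _
  · rw [Submodule.mem_comap, sides, widen_comp (p' := p + 2) _ rfl,
      widen_gen _ _ (by simp only [Piece.src]; omega)]
    exact comp_cap_mem_turnback (by omega) _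

/-- A turnback avoids the position `n - 1` that straddles the middle, so it can be interchanged with
the new central arc and brought to the outer edge. -/
theorem turnback_le_comap_arcs (n : ℕ) : turnback n ≤ (turnback (n + 1)).comap (arcs n) := by
  refine turnback_le (fun p i y hi h h' => ?_) (fun p i y hi h h' => ?_)
  · rw [Submodule.mem_comap, arcs_apply, comp_assoc, ← comp_assoc (gen .cup _ _ n)]
    rcases hi with hi | hi
    · rw [← gen_interchange .cup .cup (i := i) (k := n - 2) (p := n + n)
        (by simp only [Piece.src, Piece.tgt]; omega) (by simp only [Piece.src, Piece.tgt]; omega)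
        (by simpa only [Piece.src] using hi) (by simp only [Piece.src, Piece.tgt]; omega),
        comp_assoc]
      exact cup_comp_mem_turnback (by omega) _
    · rw [gen_interchange .cup .cup (i := n) (j := i + 2) (p' := n + n)
        (by simp only [Piece.src, Piece.tgt]; omega) (by simp only [Piece.src, Piece.tgt]; omega)
        (by simp only [Piece.src]; omega) rfl, comp_assoc]
      exact cup_comp_mem_turnback (by omega) _
  · rw [Submodule.mem_comap, arcs_apply, comp_assoc]
    rcases hi with hi | hi
    · rw [gen_interchange .cap .cap (i := i) (j := n - 2) (p' := n + n)
        (by simp only [Piece.src, Piece.tgt]; omega) (by simp only [Piece.src, Piece.tgt]; omega)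
        (by simp only [Piece.src]; omega) (by simp only [Piece.src, Piece.tgt]; omega),
        ← comp_assoc, ← comp_assoc]
      exact comp_cap_mem_turnback (by omega) _
    · rw [← gen_interchange .cap .cap (i := n) (k := i + 2) (p := n + n)
        (by simp only [Piece.src, Piece.tgt]; omega) (by simp only [Piece.src, Piece.tgt]; omega)
        (by simp only [Piece.src]; omega) (by simp only [Piece.src, Piece.tgt]),
        ← comp_assoc, ← comp_assoc]
      exact comp_cap_mem_turnback (by omega) _

/-! ### The recursion for the crossing of two bands -/

theorem mkQ_upProd_over_mul {n i a : ℕ} (hi : n ≤ i) (ha : i + a + 1 ≤ n + n)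
    (x : Skein (n + n) (n + n)) :
    (turnback n).mkQ (upProd (gen .over (n + n) (n + n)) i a * x) =
      A⁻¹ ^ a • (turnback n).mkQ x := by
  induction a generalizing i with
  | zero => rw [upProd, one_mul, pow_zero, one_smul]
  | succ a ih =>
    rw [upProd, mul_assoc, mkQ_over_mul (by omega) (by omega), ih (by omega) (by omega), smul_smul,
      pow_succ']

theorem mkQ_downProd_over_mul {n i a : ℕ} (ha : i + a + 1 ≤ n) (x : Skein (n + n) (n + n)) :
    (turnback n).mkQ (downProd (gen .over (n + n) (n + n)) i a * x) =
      A⁻¹ ^ a • (turnback n).mkQ x := by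
  induction a with
  | zero => rw [downProd, one_mul, pow_zero, one_smul]
  | succ a ih =>
    rw [downProd, mul_assoc, mkQ_over_mul (by omega) (by omega), ih (by omega), smul_smul, pow_succ']

theorem mkQ_mul_upProd_under {n i a : ℕ} (hi : n ≤ i) (ha : i + a + 1 ≤ n + n)
    (x : Skein (n + n) (n + n)) :
    (turnback n).mkQ (x * upProd (gen .under (n + n) (n + n)) i a) = A ^ a • (turnback n).mkQ x := by
  induction a with
  | zero => rw [upProd, mul_one, pow_zero, one_smul]
  | succ a ih =>
    rw [upProd_succ', ← mul_assoc, mkQ_mul_under (by omega) (by omega), ih (by omega), smul_smul,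
      pow_succ']

theorem mkQ_mul_downProd_under {n i a : ℕ} (ha : i + a + 1 ≤ n) (x : Skein (n + n) (n + n)) :
    (turnback n).mkQ (x * downProd (gen .under (n + n) (n + n)) i a) =
      A ^ a • (turnback n).mkQ x := by
  induction a generalizing i with
  | zero => rw [downProd, mul_one, pow_zero, one_smul]
  | succ a ih =>
    rw [downProd_succ', ← mul_assoc, mkQ_mul_under (by omega) (by omega), ih (by omega), smul_smul,
      pow_succ']

theorem mkQ_bandCrossing_succ (n : ℕ) :
    (turnback (n + 1)).mkQ (bandCrossing (n + 1)).toSkein =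
      A⁻¹ ^ (2 * n + 1) • (turnback (n + 1)).mkQ (sides n (bandCrossing n).toSkein) +
        A ^ (2 * n + 1) • (turnback (n + 1)).mkQ (arcs n (bandCrossing n).toSkein) := by
  rw [toSkein_bandCrossing, toSkein_bandCrossing, sides, widen_gridProd _ (by omega), zero_add]
  have hN := succ_add_succ_eq n
  have hcross : Piece.over.src = 2 ∧ Piece.over.tgt = 2 := ⟨rfl, rfl⟩
  have hcross' : Piece.under.src = 2 ∧ Piece.under.tgt = 2 := ⟨rfl, rfl⟩
  have hgg := commute_crossings (n + 1 + (n + 1)) hcross hcross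
  -- The arc left by the hook smoothing moves to the far left, its leg passes the crossing of the
  -- two `n`-bands, and the arc returns to the centre below. Its crossings have become `under`
  -- crossings, lying inside the two bottom groups.
  have hslide : Skein.comp (gen .cap (n + n) (n + 1 + (n + 1)) n)
      (downProd (gen .over (n + 1 + (n + 1)) (n + 1 + (n + 1))) 0 n * (upProd (gen .over (n + 1 + (n + 1)) (n + 1 + (n + 1))) (1 + n) n *
        gridProd (gen .over (n + 1 + (n + 1)) (n + 1 + (n + 1))) n 1 n)) =
      Skein.comp (gridProd (gen .over (n + n) (n + n)) n 0 n) (Skein.comp (gen .cap _ _ n)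
        (downProd (gen .under (n + 1 + (n + 1)) (n + 1 + (n + 1))) 0 n * upProd (gen .under (n + 1 + (n + 1)) (n + 1 + (n + 1))) (1 + n) n)) := by
    have h1 := cap_comp_downProd_over hN 0 n
    have h2 := cap_comp_upProd_over hN 0 n
    have h3 := cap_comp_gridProd hN n 0 n
    simp only [zero_add] at h1 h2
    rw [comp_mul, h1, ← comp_mul, upProd_mul_gridProd hgg
      (commute_crossings _ hcross hcross') (commute_crossings _ hcross' hcross)
      (under_mul_over_mul_over _), comp_mul, comp_mul, h3, comp_assoc, comp_mul, comp_assoc,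
      ← comp_assoc (gen .cap _ _ 0), h2]
  have harcs : ∀ x : Skein (n + 1 + (n + 1)) (n + 1 + (n + 1)),
      Skein.comp (gen .cup _ _ n) (Skein.comp (gridProd (gen .over (n + n) (n + n)) n 0 n)
        (Skein.comp (gen .cap _ _ n) x)) = arcs n (gridProd (gen .over _ _) n 0 n) * x := by
    intro x
    rw [arcs_apply, mul_def, comp_assoc, comp_assoc]
  -- With `g` the `over` generators, the product is `g n * downProd g 0 n * upProd g (1 + n) n *
  -- gridProd g n 1 n`. Only `g n`, the one crossing between the two top groups, is expanded in both
  -- terms; the remaining factors contribute `A^{∓n}` twice.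
  rw [gridProd, gridProd_succ hgg, downProd, zero_add, zero_add, mul_assoc, over_eq (by omega),
    add_mul, smul_mul_assoc, smul_mul_assoc, one_mul, map_add, map_smul, map_smul,
    mkQ_downProd_over_mul (by omega), mkQ_upProd_over_mul (by omega) (by omega), hookAt_eq hN,
    mul_def (Skein.comp _ _), comp_assoc, hslide, harcs, ← mul_assoc,
    mkQ_mul_upProd_under (by omega) (by omega), mkQ_mul_downProd_under (by omega), smul_smul,
    smul_smul, smul_smul, smul_smul]
  refine (add_comm _ _).trans ?_
  congr 2 <;> ring

/-! ### The crossingless diagrams -/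

/-- The skein element of `flatDiagram n k`, for `k ≤ n`. -/
def flat (n k : ℕ) : Skein (n + n) (n + n) :=
  ofWord _ _ (cupsWord k (n - k) ++ capsWord k (n - k))

theorem map_whisker_cupsWord (k j : ℕ) :
    (cupsWord k j).map (Layer.whisker 1 1) = cupsWord (k + 1) j := by
  induction j with
  | zero => rfl
  | succ j ih =>
    rw [cupsWord, List.map_cons, ih, cupsWord]
    congr 1
    simp only [Layer.whisker, Layer.mk.injEq, true_and]
    omega

theorem map_whisker_capsWord (k j : ℕ) :
    (capsWord k j).map (Layer.whisker 1 1) = capsWord (k + 1) j := by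
  induction j with
  | zero => rfl
  | succ j ih =>
    rw [capsWord, List.map_append, ih, capsWord]
    congr 1
    simp only [List.map_cons, List.map_nil, Layer.whisker, List.cons.injEq, Layer.mk.injEq,
      and_true, true_and]
    omega

theorem isWord_flat {n k : ℕ} (hk : k ≤ n) :
    IsWord (n + n) (n + n) (cupsWord k (n - k) ++ capsWord k (n - k)) :=
  (flatDiagram n k hk).valid

theorem sides_flat {n k : ℕ} (hk : k ≤ n) : sides n (flat n k) = flat (n + 1) (k + 1) := by
  rw [sides, flat, widen_ofWord _ _ (isWord_flat hk), List.map_append, map_whisker_cupsWord,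
    map_whisker_capsWord, flat, Nat.add_sub_add_right]

theorem arcs_flat {n k : ℕ} (hk : k ≤ n) : arcs n (flat n k) = flat (n + 1) k := by
  rw [arcs_apply, flat, gen_eq_ofWord (P := .cap) n (by simp only [Piece.src]; omega),
    comp_ofWord (isWord_flat hk), gen_comp_ofWord (r := n) (by simp only [Piece.src]; omega)
    (by simp only [Piece.tgt]; omega), flat, Nat.succ_sub hk, cupsWord, capsWord,
    Nat.add_sub_cancel' hk, List.cons_append, List.append_assoc]

/-! ### The coefficients -/

theorem quantumFactorial_succ (m : ℕ) :
    quantumFactorial (m + 1) = quantumFactorial m * quantumInt (m + 1) := by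
  rw [quantumFactorial, prod_range_succ]; rfl

theorem quantumFactorial_ne_zero (m : ℕ) : quantumFactorial m ≠ 0 :=
  prod_ne_zero_iff.2 fun i _ => quantumInt_ne_zero i

theorem quantumFactorial_zero : quantumFactorial 0 = 1 := rfl

theorem quantumBinomial_zero (n : ℕ) : quantumBinomial n 0 = 1 := by
  rw [quantumBinomial, quantumFactorial_zero, one_mul, Nat.sub_zero,
    div_self (quantumFactorial_ne_zero n)]

theorem quantumBinomial_self (n : ℕ) : quantumBinomial n n = 1 := by
  rw [quantumBinomial, Nat.sub_self, quantumFactorial_zero, mul_one,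
    div_self (quantumFactorial_ne_zero n)]

/-- Split `[n + 1]` as a combination of `[n - k]` and `[k + 1]` by `quantumInt_add`; each part
cancels one factor of the denominator. -/
theorem quantumBinomial_succ_succ {n k : ℕ} (hk : k < n) :
    quantumBinomial (n + 1) (k + 1) = A⁻¹ ^ (2 * (n - k)) * quantumBinomial n k +
      A ^ (2 * (k + 1)) * quantumBinomial n (k + 1) := by
  obtain ⟨j, rfl⟩ : ∃ j, n = k + j + 1 := ⟨n - k - 1, by omega⟩
  have h := quantumInt_add (j + 1) (k + 1)
  rw [show j + 1 + (k + 1) = k + j + 1 + 1 by omega] at h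
  simp only [quantumBinomial]
  rw [show k + j + 1 + 1 - (k + 1) = j + 1 by omega, show k + j + 1 - (k + 1) = j by omega,
    show k + j + 1 - k = j + 1 by omega, quantumFactorial_succ (k + j + 1), h,
    quantumFactorial_succ k, quantumFactorial_succ j]
  have h1 := quantumFactorial_ne_zero k
  have h2 := quantumFactorial_ne_zero j
  have h3 := quantumInt_ne_zero k
  have h4 := quantumInt_ne_zero j
  generalize A⁻¹ ^ (2 * (j + 1)) = x
  generalize A ^ (2 * (k + 1)) = y
  field_simp

theorem coeff_succ_zero (n : ℕ) : coeff (n + 1) 0 = A ^ (2 * n + 1) * coeff n 0 := by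
  rw [coeff, coeff, quantumBinomial_zero, quantumBinomial_zero, mul_one, mul_one, ← zpow_natCast A,
    ← zpow_add₀ A_ne_zero]
  congr 1
  push_cast
  ring

/-- The end case is separate because `quantumBinomial n (n + 1)` is not `0`: the truncated
difference `n - (n + 1)` gives `1 / [n + 1]`. -/
theorem coeff_succ_self (n : ℕ) : coeff (n + 1) (n + 1) = A⁻¹ ^ (2 * n + 1) * coeff n n := by
  rw [coeff, coeff, quantumBinomial_self, quantumBinomial_self, mul_one, mul_one, inv_pow,
    ← zpow_natCast A, ← zpow_neg, ← zpow_add₀ A_ne_zero]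
  congr 1
  push_cast
  ring

theorem coeff_succ_succ {n k : ℕ} (hk : k < n) :
    coeff (n + 1) (k + 1) = A⁻¹ ^ (2 * n + 1) * coeff n k + A ^ (2 * n + 1) * coeff n (k + 1) := by
  rw [coeff, coeff, coeff, quantumBinomial_succ_succ hk, mul_add, ← mul_assoc, ← mul_assoc,
    ← mul_assoc, ← mul_assoc, inv_pow, inv_pow]
  simp only [← zpow_natCast A, ← zpow_neg, ← zpow_add₀ A_ne_zero]
  congr 3
  · push_cast [hk.le]
    ring
  · push_cast
    ring

/-! ### The expansion of the crossing -/

theorem mkQ_bandCrossing (n : ℕ) :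
    (turnback n).mkQ (bandCrossing n).toSkein =
      ∑ k ∈ range (n + 1), coeff n k • (turnback n).mkQ (flat n k) := by
  induction n with
  | zero =>
    change _ = ∑ k ∈ range 1, _
    rw [sum_range_one, coeff, quantumBinomial_self, Nat.cast_zero, zero_mul, zpow_zero,
      mul_one, one_smul, toSkein_eq_ofWord]
    rfl
  | succ n ih =>
    -- The inductive hypothesis is restated as membership, the form in which `sides` and `arcs`
    -- carry it to the next turnback subspace.
    have hmem : (bandCrossing n).toSkein - ∑ k ∈ range (n + 1), coeff n k • flat n k ∈
        turnback n := by
      rw [← Submodule.Quotient.mk_eq_zero, ← Submodule.mkQ_apply, map_sub, ih, map_sum, sub_eq_zero]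
      simp only [map_smul]
    have hsides := (Submodule.Quotient.mk_eq_zero (turnback (n + 1))).2 (turnback_le_comap_sides n hmem)
    have harcs := (Submodule.Quotient.mk_eq_zero (turnback (n + 1))).2 (turnback_le_comap_arcs n hmem)
    rw [← Submodule.mkQ_apply, map_sub, map_sub, sub_eq_zero, map_sum, map_sum] at hsides harcs
    have es : ∀ k ∈ range (n + 1), (turnback (n + 1)).mkQ (sides n (coeff n k • flat n k)) =
        coeff n k • (turnback (n + 1)).mkQ (flat (n + 1) (k + 1)) := fun k hk => by
      rw [map_smul, map_smul, sides_flat (by simpa [Nat.lt_succ_iff] using hk)]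
    have ea : ∀ k ∈ range (n + 1), (turnback (n + 1)).mkQ (arcs n (coeff n k • flat n k)) =
        coeff n k • (turnback (n + 1)).mkQ (flat (n + 1) k) := fun k hk => by
      rw [map_smul, map_smul, arcs_flat (by simpa [Nat.lt_succ_iff] using hk)]
    rw [mkQ_bandCrossing_succ, hsides, harcs, sum_congr rfl es, sum_congr rfl ea]
    generalize (turnback (n + 1)).mkQ = q
    have ec : ∀ k ∈ range n, coeff (n + 1) (k + 1) • q (flat (n + 1) (k + 1)) =
        (A⁻¹ ^ (2 * n + 1) * coeff n k + A ^ (2 * n + 1) * coeff n (k + 1)) •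
          q (flat (n + 1) (k + 1)) := fun k hk => by rw [coeff_succ_succ (mem_range.1 hk)]
    -- `sides` raises `k` by one and `arcs` keeps it, so the terms `k = 0` and `k = n + 1` receive
    -- one contribution each and are split off; the others satisfy the Pascal rule.
    rw [sum_range_succ' (fun k => coeff (n + 1) k • q (flat (n + 1) k)) (n + 1),
      sum_range_succ (fun k => coeff (n + 1) (k + 1) • q (flat (n + 1) (k + 1))) n,
      sum_range_succ (fun k => coeff n k • q (flat (n + 1) (k + 1))) n,
      sum_range_succ' (fun k => coeff n k • q (flat (n + 1) k)) n, coeff_succ_zero, coeff_succ_self,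
      sum_congr rfl ec]
    simp only [smul_add, smul_sum, smul_smul, add_smul, sum_add_distrib]
    abel

theorem coloredCrossing_eq (n : ℕ) :
    coloredCrossing n = decorateMap n (bandCrossing n).toSkein := rfl

theorem flatElement_eq (n k : ℕ) (hk : k ≤ n) :
    flatElement n k hk = decorateMap n (flat n k) := by
  change decorateMap n (flatDiagram n k hk).toSkein = _
  rw [toSkein_eq_ofWord]
  rfl

end KauffmanSkein

end

theorem mainTheorem5 (n : ℕ) :
    KauffmanSkein.coloredCrossing n =
      ∑ k : Fin (n + 1), KauffmanSkein.coeff n k •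
        KauffmanSkein.flatElement n k (Nat.lt_succ_iff.mp k.isLt) := by
  -- Decoration factors through the quotient by turnbacks, so it can be applied to the expansion
  -- there.
  have h := congrArg ((KauffmanSkein.turnback n).liftQ (KauffmanSkein.decorateMap n)
    (KauffmanSkein.turnback_le_ker_decorateMap n)) (KauffmanSkein.mkQ_bandCrossing n)
  simp only [map_sum, map_smul, Submodule.mkQ_apply, Submodule.liftQ_apply] at h
  rw [KauffmanSkein.coloredCrossing_eq, h, Finset.sum_range]
  simp only [KauffmanSkein.flatElement_eq]
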